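/- Let $G$ be a (finite-dimensional, real, smooth) local Lie group with unit $e$ and Lie algebra $\mathfrak g$, let $H$ be a local closed Lie subgroup with Lie algebra $\mathfrak h$, and let $Q\ni e$ be, near $e$, a smooth section of the left cosets $G/H$, i.e. a submanifold through $e$ whose tangent space $V=T_eQ\subset\mathfrak g$ satisfies $\mathfrak g=V\oplus\mathfrak h$. Let $\Pi:\mathfrak g\to V$ be the projection along $\mathfrak h$. There is a map $\varphi:V\to\mathfrak h$, continuous at $0$ with $\varphi(0)=0$, such that $\exp(\xi+\varphi(\xi))\in Q$ for all $\xi\in V$ near $0$. Any such $\varphi$ is smooth at $0$ with $d\varphi(0)=0$; let $R=\tfrac12 D^2\varphi(0)$ be its quadratic part, a symmetric bilinear map $V\times V\to\mathfrak h$, so that $\varphi(\xi)=R(\xi,\xi)+O(|\xi|^3)$. Use $\bar x\in V$ as (normal) coordinate of the point $x=\exp(\bar x+\varphi(\bar x))$ of $Q$. Let $\times$ be the local loop operation on $Q$ in which $x\times y$ is the point of $Q$ near $e$ with $x\cdot y\in(x\times y)H$, and let $\mu:V\times V\to V$, $\mu(\bar x,\bar y)=\overline{x\times y}$, be its expression in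 normal coordinates; it is smooth near $(0,0)$. Consider on $V\times V$ near $(0,0)$ the 3-web with leaves $x=\mathrm{const}$, $y=\mathrm{const}$, $\mu(x,y)=\mathrm{const}$, the forms $\omega_1^i=\frac{\partial\mu^i}{\partial x^\alpha}dx^\alpha$, $\omega_2^i=\frac{\partial\mu^i}{\partial y^\beta}dy^\beta$, and the Chern connection $\omega^k_j=\Gamma^k_{ij}\omega_1^i+\Gamma^k_{jl}\omega_2^l$, where $\Gamma^k_{ij}=-\tilde P^\alpha_i\tilde Q^\beta_j\frac{\partial^2\mu^k}{\partial x^\alpha\partial y^\beta}$ and $\tilde P,\tilde Q$ are the inverses of the matrices $\left(\frac{\partial\mu^i}{\partial x^\alpha}\right)$, $\left(\frac{\partial\mu^i}{\partial y^\beta}\right)$. The torsion tensor $a^k_{ij}=-a^k_{ji}$ and the curvature tensor $b^k_{jlm}$ of the web are defined by the structure equations $$d\omega_1^k=\omega_1^l\wedge\omega^k_l+a^k_{ij}\,\omega_1^i\wedge\omega_1^j,\qquad d\omega_2^k=\omega_2^l\wedge\omega^k_l-a^k_{ij}\,\omega_2^i\wedge\omega_2^j,\qquad d\omega^k_j=\omega^i_j\wedge\omega^k_i+b^k_{jlm}\,\omega_1^l\wedge\omega_2^m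 .$$ Write $a(x,y)^k=a^k_{ij}x^iy^j$ and $b(x,y,z)^k=b^k_{jlm}x^jy^lz^m$ for their values at the point $(e,e)$, i.e. at $(0,0)$ in the coordinates. Then these values exist, are unique, and for all $x,y,z\in V$ $$a(x,y)=-\tfrac12\,\Pi[x,y],$$ $$b(x,y,z)=-\tfrac12\,\Pi[[x,y],z]+\tfrac12\,\Pi[\Pi[x,y],z]-2\,\Pi[R(x,y),z].$$ -/

import Mathlib

open Set Filter Topology
open scoped ContDiff

noncomputable section

/-- A (smooth) local Lie group, written in a chart of the model space `E` centred at the unit, so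
that the unit is `0`. The chart is arbitrary: it is not assumed to be a normal chart.
Products are meaningful on `U × U`, inverses on `U₀ ⊆ U`. -/
structure LocalLieGroup (E : Type*) [NormedAddCommGroup E] [NormedSpace ℝ E] where
  U : Set E
  U₀ : Set E
  isOpen_U : IsOpen U
  isOpen_U₀ : IsOpen U₀
  zero_mem_U₀ : (0 : E) ∈ U₀
  U₀_subset : U₀ ⊆ U
  mul : E → E → E
  inv : E → E
  contDiffOn_mul : ContDiffOn ℝ ∞ (fun p : E × E => mul p.1 p.2) (U ×ˢ U)
  contDiffOn_inv : ContDiffOn ℝ ∞ inv U₀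
  inv_mem : ∀ x ∈ U₀, inv x ∈ U
  zero_mul : ∀ x ∈ U, mul 0 x = x
  mul_zero : ∀ x ∈ U, mul x 0 = x
  inv_mul : ∀ x ∈ U₀, mul (inv x) x = 0
  mul_inv : ∀ x ∈ U₀, mul x (inv x) = 0
  mul_assoc : ∀ x ∈ U, ∀ y ∈ U, ∀ z ∈ U, mul x y ∈ U → mul y z ∈ U →
    mul (mul x y) z = mul x (mul y z)

/-- Near `0`, the set `S` is a smooth embedded submanifold passing through `0` with tangent
space `T` at `0`: some chart `Φ`, normalised to have the identity as its derivative
at `0`, maps `S` onto the linear subspace `T`. -/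
def IsSubmanifoldAtZero {E : Type*} [NormedAddCommGroup E] [NormedSpace ℝ E]
    (S : Set E) (T : Submodule ℝ E) : Prop :=
  ∃ Φ : OpenPartialHomeomorph E E, (0 : E) ∈ Φ.source ∧ Φ 0 = 0 ∧
    ContDiffOn ℝ ∞ Φ Φ.source ∧ ContDiffOn ℝ ∞ Φ.symm Φ.target ∧
    HasFDerivAt Φ (ContinuousLinearMap.id ℝ E) 0 ∧
    ∀ x ∈ Φ.source, x ∈ S ↔ Φ x ∈ T

namespace LocalLieGroup

variable {E : Type*} [NormedAddCommGroup E] [NormedSpace ℝ E]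

/-- The left-invariant vector field `g ↦ d(L_g)₀ ξ` with value `ξ` at the unit. -/
def leftInvariantField (G : LocalLieGroup E) (ξ : E) : E → E :=
  fun g => fderiv ℝ (fun y => G.mul g y) 0 ξ

/-- The bracket of the Lie algebra `T₀ G = E`: the value at the unit of the Lie bracket of
left-invariant vector fields. -/
def bracket (G : LocalLieGroup E) (ξ η : E) : E :=
  VectorField.lieBracket ℝ (G.leftInvariantField ξ) (G.leftInvariantField η) 0

/-- `g` is the endpoint at time `1` of the integral curve, issued from the unit, of the
left-invariant vector field of `ξ`. -/
def IsExp (G : LocalLieGroup E) (ξ g : E) : Prop :=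
  ∃ γ : ℝ → E, γ 0 = 0 ∧ γ 1 = g ∧ ∀ t ∈ Icc (0 : ℝ) 1, γ t ∈ G.U ∧
    HasDerivWithinAt γ (G.leftInvariantField ξ (γ t)) (Icc 0 1) t

open Classical in
/-- The exponential map (with value `0` where the integral curve does not live up to time `1`;
this does not happen for `ξ` near `0`). -/
def exp (G : LocalLieGroup E) (ξ : E) : E :=
  if h : ∃ g, G.IsExp ξ g then h.choose else 0

/-- `H` is a (locally closed) local Lie subgroup of `G` with Lie algebra `𝔥`. -/
structure IsLocalLieSubgroup (G : LocalLieGroup E) (H : Set E) (𝔥 : Submodule ℝ E) : Prop where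
  subset_U : H ⊆ G.U
  isSubmanifold : IsSubmanifoldAtZero H 𝔥
  mul_mem : ∃ W ∈ 𝓝 (0 : E), ∀ x ∈ H ∩ W, ∀ y ∈ H ∩ W, G.mul x y ∈ H
  inv_mem : ∃ W ∈ 𝓝 (0 : E), ∀ x ∈ H ∩ W, G.inv x ∈ H

/-- `Q` is, near the unit, a smooth section of the left cosets of the local subgroup with Lie
algebra `𝔥`, with tangent space `V` at the unit: a submanifold through the unit,
transversal to the cosets and of complementary dimension. -/
structure IsLocalSection (Q : Set E) (V 𝔥 : Submodule ℝ E) : Prop where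
  isSubmanifold : IsSubmanifoldAtZero Q V
  isCompl : IsCompl V 𝔥

/-- The point of `G` with normal coordinate `x ∈ V`, namely `exp (x + φ x)`. -/
def point (G : LocalLieGroup E) {V 𝔥 : Submodule ℝ E} (φ : V → 𝔥) (x : V) : E :=
  G.exp ((x : E) + (φ x : E))

/-- `φ : V → 𝔥` is the map (a germ at `0`) defined by `exp (ξ + φ ξ) ∈ Q`. -/
structure IsSectionMap (G : LocalLieGroup E) (Q : Set E) {V 𝔥 : Submodule ℝ E}
    (φ : V → 𝔥) : Prop where
  map_zero : φ 0 = 0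
  continuousAt : ContinuousAt φ 0
  mem : ∀ᶠ ξ in 𝓝 (0 : V), G.point φ ξ ∈ Q

/-- `q` is a projection of `g` on `Q` parallel to `H`: `q ∈ Q` and `g ∈ q H`. -/
def IsProjection (G : LocalLieGroup E) (H Q : Set E) (g q : E) : Prop :=
  q ∈ Q ∧ ∃ h ∈ H, g = G.mul q h

/-- `μ` is (a germ at `(0, 0)` of) the composition law `x × y = Π_Q (x · y)` of the local loop `Q`,
written in the normal coordinates of `Q`. -/
structure IsLoopLaw (G : LocalLieGroup E) (H Q : Set E) {V 𝔥 : Submodule ℝ E} (φ : V → 𝔥)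
    (μ : V × V → V) : Prop where
  map_zero : μ 0 = 0
  continuousAt : ContinuousAt μ 0
  isProjection : ∀ᶠ p in 𝓝 (0 : V × V),
    G.IsProjection H Q (G.mul (G.point φ p.1) (G.point φ p.2)) (G.point φ (μ p))

end LocalLieGroup

/-- The quadratic part `R` of a map `φ` at `0`: the symmetric bilinear map `D²φ(0) / 2`, so that
`φ ξ = φ 0 + Dφ(0) ξ + R (ξ, ξ) + …`. -/
def quadraticPart {V W : Type*} [NormedAddCommGroup V] [NormedSpace ℝ V]
    [NormedAddCommGroup W] [NormedSpace ℝ W] (φ : V → W) (x y : V) : W :=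
  (1 / 2 : ℝ) • fderiv ℝ (fderiv ℝ φ) 0 x y

/-! The 3-web on `V × V` whose leaves are `x = const`, `y = const` and `μ (x, y) = const`, with its
Chern connection. Forms with one upper index are written as `V`-valued forms. -/

namespace ThreeWeb

variable {V : Type*} [NormedAddCommGroup V] [NormedSpace ℝ V]

/-- `P = ∂μ/∂x`. -/
def P (μ : V × V → V) (p : V × V) : V →L[ℝ] V := fderiv ℝ (fun x => μ (x, p.2)) p.1

/-- `Q = ∂μ/∂y`. -/
def Q (μ : V × V → V) (p : V × V) : V →L[ℝ] V := fderiv ℝ (fun y => μ (p.1, y)) p.2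

/-- `∂²μ/∂x∂y`, applied first to the `x`-direction and then to the `y`-direction. -/
def mixed (μ : V × V → V) (p : V × V) : V →L[ℝ] V →L[ℝ] V :=
  fderiv ℝ (fun x => Q μ (x, p.2)) p.1

/-- `ω₁ = P dx`. -/
def ω₁ (μ : V × V → V) (p : V × V) : V × V →L[ℝ] V := (P μ p).comp (.fst ℝ V V)

/-- `ω₂ = Q dy`. -/
def ω₂ (μ : V × V → V) (p : V × V) : V × V →L[ℝ] V := (Q μ p).comp (.snd ℝ V V)

/-- `Γ(u, v) = - ∂²μ/∂x∂y (P⁻¹ u, Q⁻¹ v)`. -/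
def Γ (μ : V × V → V) (p : V × V) : V →L[ℝ] V →L[ℝ] V :=
  -(mixed μ p).bilinearComp (P μ p).inverse (Q μ p).inverse

/-- The form `ω_v = Γ(ω₁, v) + Γ(v, ω₂)` of the Chern connection; for `v` the `j`-th basis
vector its components are the `ω^k_j = Γ^k_{ij} ω₁^i + Γ^k_{jl} ω₂^l`. -/
def connectionForm (μ : V × V → V) (v : V) (p : V × V) : V × V →L[ℝ] V :=
  ((Γ μ p).flip v).comp (ω₁ μ p) + (Γ μ p v).comp (ω₂ μ p)

/-- Exterior derivative of a `V`-valued 1-form, evaluated on two vectors: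
`dα(u, w) = (D_u α)(w) - (D_w α)(u)`. -/
def d (α : V × V → (V × V →L[ℝ] V)) (p u w : V × V) : V :=
  extDeriv (fun q => ContinuousAlternatingMap.ofSubsingleton ℝ (V × V) V (0 : Fin 1) (α q)) p
    ![u, w]

/-- `a` and `b` are the values at `p` of the torsion tensor and of the curvature tensor of the
3-web: `a` is skew-symmetric and the structure equations
`dω₁^k = ω₁^l ∧ ω^k_l + a^k_{ij} ω₁^i ∧ ω₁^j`,
`dω₂^k = ω₂^l ∧ ω^k_l - a^k_{ij} ω₂^i ∧ ω₂^j`,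
`dω^k_j = ω^i_j ∧ ω^k_i + b^k_{jlm} ω₁^l ∧ ω₂^m`
hold at `p`, where `(α ∧ β)(u, w) = α(u) β(w) - α(w) β(u)`,
`a(x, y)^k = a^k_{ij} x^i y^j` and `b(x, y, z)^k = b^k_{jlm} x^j y^l z^m`. -/
structure HasTensorsAt (μ : V × V → V) (p : V × V) (a : V →ₗ[ℝ] V →ₗ[ℝ] V)
    (b : V →ₗ[ℝ] V →ₗ[ℝ] V →ₗ[ℝ] V) : Prop where
  skew : ∀ x y, a x y = -a y x
  d_ω₁ : ∀ u w, d (ω₁ μ) p u w =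
    (connectionForm μ (ω₁ μ p u) p w - connectionForm μ (ω₁ μ p w) p u) +
      (a (ω₁ μ p u) (ω₁ μ p w) - a (ω₁ μ p w) (ω₁ μ p u))
  d_ω₂ : ∀ u w, d (ω₂ μ) p u w =
    (connectionForm μ (ω₂ μ p u) p w - connectionForm μ (ω₂ μ p w) p u) -
      (a (ω₂ μ p u) (ω₂ μ p w) - a (ω₂ μ p w) (ω₂ μ p u))
  d_connectionForm : ∀ v u w, d (connectionForm μ v) p u w =
    (connectionForm μ (connectionForm μ v p u) p w -
      connectionForm μ (connectionForm μ v p w) p u) +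
      (b v (ω₁ μ p u) (ω₂ μ p w) - b v (ω₁ μ p w) (ω₂ μ p u))

end ThreeWeb

end

/-! In normal coordinates the group law is a germ `m` with `m (x, 0) = x`, `m (0, y) = y` and
`m (x, x) = 2 x`. Together with associativity these identities determine its Taylor expansion up
to order three: the mixed second derivative is half the bracket, and the mixed third derivatives
are double brackets. Comparing the terms of degree two and three in the equation
`x · y = (x × y) · h`, `h ∈ H`, and projecting along `𝔥`, gives the third-order expansion of the
loop law `μ`. The values at the unit of the torsion and curvature of the web are polynomials in the
mixed second and third derivatives of `μ`. -/

noncomputable section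

section Calculus

variable {W X Y Z : Type*} [NormedAddCommGroup W] [NormedSpace ℝ W]
  [NormedAddCommGroup X] [NormedSpace ℝ X] [NormedAddCommGroup Y] [NormedSpace ℝ Y]
  [NormedAddCommGroup Z] [NormedSpace ℝ Z]

theorem differentiableAt_flip {f : W → X →L[ℝ] Y →L[ℝ] Z} {p : W}
    (hf : DifferentiableAt ℝ f p) : DifferentiableAt ℝ (fun q => (f q).flip) p := by
  let L : (X →L[ℝ] Y →L[ℝ] Z) →L[ℝ] (Y →L[ℝ] X →L[ℝ] Z) :=
    (ContinuousLinearMap.flipₗᵢ ℝ X Y Z).toContinuousLinearEquiv.toContinuousLinearMap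
  exact DifferentiableAt.comp (𝕜 := ℝ) (F := X →L[ℝ] Y →L[ℝ] Z) (G := Y →L[ℝ] X →L[ℝ] Z) (g := L)
    p L.differentiableAt hf

theorem differentiableAt_bilinearComp {f : W → X →L[ℝ] X →L[ℝ] Z} {g h : W → Y →L[ℝ] X}
    {p : W} (hf : DifferentiableAt ℝ f p) (hg : DifferentiableAt ℝ g p)
    (hh : DifferentiableAt ℝ h p) :
    DifferentiableAt ℝ (fun q => (f q).bilinearComp (g q) (h q)) p :=
  differentiableAt_flip ((differentiableAt_flip (hf.clm_comp hg)).clm_comp hh)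

theorem fderiv_clm_apply_apply {f : W → X →L[ℝ] Y →L[ℝ] Z} {p : W}
    (hf : DifferentiableAt ℝ f p) (u : W) (x : X) (y : Y) :
    fderiv ℝ (fun q => f q x y) p u = fderiv ℝ f p u x y := by
  rw [((hf.hasFDerivAt.clm_apply (hasFDerivAt_const x p)).clm_apply
    (hasFDerivAt_const y p)).fderiv]
  simp

theorem hasFDerivAt_inverse_id [CompleteSpace X] : HasFDerivAt
    (ContinuousLinearMap.inverse : (X →L[ℝ] X) → X →L[ℝ] X) (-.id ℝ (X →L[ℝ] X)) (.id ℝ X) := by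
  have h := hasFDerivAt_ringInverse (𝕜 := ℝ) (1 : (X →L[ℝ] X)ˣ)
  rw [ContinuousLinearMap.ringInverse_eq_inverse] at h
  refine h.congr_fderiv ?_
  ext A x
  simp

end Calculus

section Taylor

open Asymptotics

variable {X Y : Type*} [NormedAddCommGroup X] [NormedSpace ℝ X]
  [NormedAddCommGroup Y] [NormedSpace ℝ Y]

theorem eventually_differentiableAt_of_contDiffAt {F : X → Y} {x : X} (hF : ContDiffAt ℝ 1 F x) :
    ∀ᶠ y in 𝓝 x, DifferentiableAt ℝ F y := by
  filter_upwards [hF.eventually (by simp)] with y hy using hy.differentiableAt one_ne_zero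

theorem fderiv_fderiv_symm {F : X → Y} {x : X} (hF : ContDiffAt ℝ 2 F x) (u v : X) :
    fderiv ℝ (fderiv ℝ F) x u v = fderiv ℝ (fderiv ℝ F) x v u :=
  (hF.isSymmSndFDerivAt (by simp)).eq u v

theorem fderiv_fderiv_fderiv_symm_left {F : X → Y} {x : X} (hF : ContDiffAt ℝ 3 F x)
    (u v w : X) : fderiv ℝ (fderiv ℝ (fderiv ℝ F)) x u v w =
      fderiv ℝ (fderiv ℝ (fderiv ℝ F)) x v u w := by
  rw [fderiv_fderiv_symm (hF.fderiv_right (by norm_num))]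

theorem fderiv_fderiv_fderiv_symm_right {F : X → Y} {x : X} (hF : ContDiffAt ℝ 3 F x)
    (u v w : X) : fderiv ℝ (fderiv ℝ (fderiv ℝ F)) x u v w =
      fderiv ℝ (fderiv ℝ (fderiv ℝ F)) x u w v := by
  have hF' : ContDiffAt ℝ 1 (fderiv ℝ (fderiv ℝ F)) x :=
    (hF.fderiv_right (m := 2) (by norm_num)).fderiv_right (by norm_num)
  have hd := hF'.differentiableAt one_ne_zero
  rw [← fderiv_clm_apply_apply hd, ← fderiv_clm_apply_apply hd]
  congr 1
  apply Filter.EventuallyEq.fderiv_eq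
  filter_upwards [(hF.of_le (by norm_num) : ContDiffAt ℝ 2 F x).eventually (by simp)] with y hy
  exact fderiv_fderiv_symm hy v w

theorem isLittleO_pow_succ_of_fderiv {g : X → Y} {n : ℕ} (h0 : g 0 = 0)
    (hd : ∀ᶠ x in 𝓝 (0 : X), DifferentiableAt ℝ g x)
    (ho : fderiv ℝ g =o[𝓝 0] fun x => ‖x‖ ^ n) : g =o[𝓝 0] fun x => ‖x‖ ^ (n + 1) := by
  rw [isLittleO_iff] at ho ⊢
  intro ε hε
  obtain ⟨r, hr, hball⟩ := Metric.eventually_nhds_iff_ball.1 (hd.and (ho hε))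
  filter_upwards [Metric.ball_mem_nhds (0 : X) hr] with x hx
  have hsub : Metric.closedBall (0 : X) ‖x‖ ⊆ Metric.ball 0 r :=
    Metric.closedBall_subset_ball (by simpa using hx)
  have hbound : ∀ y ∈ Metric.closedBall (0 : X) ‖x‖, ‖fderiv ℝ g y‖ ≤ ε * ‖x‖ ^ n := by
    intro y hy
    have hyx : ‖y‖ ≤ ‖x‖ := by simpa using hy
    refine (hball y (hsub hy)).2.trans ?_
    simp only [norm_pow, norm_norm]
    gcongr
  have hmvt := (convex_closedBall (0 : X) ‖x‖).norm_image_sub_le_of_norm_fderiv_le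
    (fun y hy => (hball y (hsub hy)).1) hbound (x := 0) (y := x) (by simp) (by simp)
  simpa [h0, pow_succ, mul_assoc] using hmvt

theorem taylor_two_isLittleO {F : X → Y} (hF : ContDiffAt ℝ 2 F 0) :
    (fun x => F x - (F 0 + fderiv ℝ F 0 x + (1 / 2 : ℝ) • fderiv ℝ (fderiv ℝ F) 0 x x))
      =o[𝓝 0] fun x => ‖x‖ ^ 2 := by
  have hsymm := fderiv_fderiv_symm hF
  have hF' : ContDiffAt ℝ 1 (fderiv ℝ F) 0 := hF.fderiv_right (by norm_num)
  have hdiff := eventually_differentiableAt_of_contDiffAt (hF.of_le one_le_two)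
  have hrem := (hF'.differentiableAt one_ne_zero).hasFDerivAt.isLittleO
  set F₁ := fderiv ℝ F 0
  set F₂ := fderiv ℝ (fderiv ℝ F) 0
  have hpoly (x : X) : HasFDerivAt (fun x => F 0 + F₁ x + (1 / 2 : ℝ) • F₂ x x) (F₁ + F₂ x) x := by
    refine (((F₁.hasFDerivAt (x := x)).const_add (F 0)).add
      (((F₂.hasFDerivAt (x := x)).clm_apply (hasFDerivAt_id x)).const_smul
        (1 / 2 : ℝ))).congr_fderiv ?_
    ext u
    simp only [add_apply, smul_apply, ContinuousLinearMap.comp_apply, ContinuousLinearMap.coe_id',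
      id_eq, ContinuousLinearMap.flip_apply, hsymm u x]
    module
  refine isLittleO_pow_succ_of_fderiv (n := 1) (by simp) ?_ ?_
  · filter_upwards [hdiff] with x hx using hx.sub (hpoly x).differentiableAt
  · simp only [sub_zero, pow_one] at hrem ⊢
    refine (hrem.congr' ?_ .rfl).norm_right
    filter_upwards [hdiff] with x hx
    rw [(hx.hasFDerivAt.fun_sub (hpoly x)).fderiv, sub_sub]

theorem taylor_three_isLittleO {F : X → Y} (hF : ContDiffAt ℝ 3 F 0) :
    (fun x => F x - (F 0 + fderiv ℝ F 0 x + (1 / 2 : ℝ) • fderiv ℝ (fderiv ℝ F) 0 x x +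
      (1 / 6 : ℝ) • fderiv ℝ (fderiv ℝ (fderiv ℝ F)) 0 x x x)) =o[𝓝 0] fun x => ‖x‖ ^ 3 := by
  have hsymm := fderiv_fderiv_symm (hF.of_le (by norm_num))
  have hsymm₁ := fderiv_fderiv_fderiv_symm_left hF
  have hsymm₂ := fderiv_fderiv_fderiv_symm_right hF
  have hdiff := eventually_differentiableAt_of_contDiffAt (hF.of_le (by norm_num))
  have hrem := taylor_two_isLittleO (hF.fderiv_right (m := 2) (by norm_num))
  set F₁ := fderiv ℝ F 0
  set F₂ := fderiv ℝ (fderiv ℝ F) 0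
  set F₃ := fderiv ℝ (fderiv ℝ (fderiv ℝ F)) 0
  have hpoly (x : X) : HasFDerivAt (fun x => F 0 + F₁ x + (1 / 2 : ℝ) • F₂ x x +
      (1 / 6 : ℝ) • F₃ x x x) (F₁ + F₂ x + (1 / 2 : ℝ) • F₃ x x) x := by
    refine ((((F₁.hasFDerivAt (x := x)).const_add (F 0)).add
      (((F₂.hasFDerivAt (x := x)).clm_apply (hasFDerivAt_id x)).const_smul (1 / 2 : ℝ))).add
      ((((F₃.hasFDerivAt (x := x)).clm_apply (hasFDerivAt_id x)).clm_apply
        (hasFDerivAt_id x)).const_smul (1 / 6 : ℝ))).congr_fderiv ?_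
    ext u
    simp only [add_apply, smul_apply, ContinuousLinearMap.comp_apply, ContinuousLinearMap.coe_id',
      id_eq, ContinuousLinearMap.flip_apply, hsymm u x, hsymm₁ u x x, hsymm₂ x u x]
    module
  refine isLittleO_pow_succ_of_fderiv (n := 2) (by simp) ?_ (hrem.congr' ?_ .rfl)
  · filter_upwards [hdiff] with x hx using hx.sub (hpoly x).differentiableAt
  · filter_upwards [hdiff] with x hx
    rw [(hx.hasFDerivAt.fun_sub (hpoly x)).fderiv]

end Taylor

section Jets

variable {X Y Z : Type*} [NormedAddCommGroup X] [NormedSpace ℝ X]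
  [NormedAddCommGroup Y] [NormedSpace ℝ Y] [NormedAddCommGroup Z] [NormedSpace ℝ Z]

/-- The curve `f` has the third order expansion `f t = t a + t² b + t³ c + o(t³)` at `0`. The
remainder is absorbed in a coefficient `k t → c`, which makes bilinear operations on expansions
purely algebraic. -/
def HasCubicJet (f : ℝ → X) (a b c : X) : Prop :=
  ∃ k : ℝ → X, Tendsto k (𝓝 0) (𝓝 c) ∧ ∀ᶠ t in 𝓝 (0 : ℝ), f t = t • a + t ^ 2 • b + t ^ 3 • k t

theorem eq_zero_of_pow_smul_eventually_eq_zero {n : ℕ} {w : ℝ → X} {u : X}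
    (hw : Tendsto w (𝓝[≠] 0) (𝓝 u)) (h : ∀ᶠ t in 𝓝[≠] (0 : ℝ), t ^ n • w t = 0) : u = 0 := by
  refine tendsto_nhds_unique hw (tendsto_const_nhds.congr' ?_)
  filter_upwards [h, self_mem_nhdsWithin] with t ht ht0
  exact ((smul_eq_zero.1 ht).resolve_left (pow_ne_zero _ ht0)).symm

namespace HasCubicJet

variable {f g : ℝ → X} {a b c a' b' c' : X}

theorem congr' (hf : HasCubicJet f a b c) (h : f =ᶠ[𝓝 0] g) : HasCubicJet g a b c := by
  obtain ⟨k, hk, hfk⟩ := hf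
  exact ⟨k, hk, by filter_upwards [hfk, h] with t h1 h2 using h2 ▸ h1⟩

theorem congr_coeff (hf : HasCubicJet f a b c) (ha : a = a') (hb : b = b') (hc : c = c') :
    HasCubicJet f a' b' c' := by
  subst ha hb hc; exact hf

theorem line (x : X) : HasCubicJet (fun t => t • x) x 0 0 :=
  ⟨fun _ => 0, tendsto_const_nhds, by simp⟩

theorem add (hf : HasCubicJet f a b c) (hg : HasCubicJet g a' b' c') :
    HasCubicJet (fun t => f t + g t) (a + a') (b + b') (c + c') := by
  obtain ⟨k, hk, hfk⟩ := hf
  obtain ⟨l, hl, hgl⟩ := hg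
  refine ⟨fun t => k t + l t, hk.add hl, ?_⟩
  filter_upwards [hfk, hgl] with t h1 h2
  rw [h1, h2]; module

theorem smul (hf : HasCubicJet f a b c) (r : ℝ) :
    HasCubicJet (fun t => r • f t) (r • a) (r • b) (r • c) := by
  obtain ⟨k, hk, hfk⟩ := hf
  refine ⟨fun t => r • k t, hk.const_smul r, ?_⟩
  filter_upwards [hfk] with t h1
  rw [h1]; module

theorem clm (hf : HasCubicJet f a b c) (L : X →L[ℝ] Y) :
    HasCubicJet (fun t => L (f t)) (L a) (L b) (L c) := by
  obtain ⟨k, hk, hfk⟩ := hf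
  refine ⟨fun t => L (k t), (L.continuous.tendsto c).comp hk, ?_⟩
  filter_upwards [hfk] with t h1
  simp [h1]

theorem prodMk {g : ℝ → Y} {a' b' c' : Y} (hf : HasCubicJet f a b c)
    (hg : HasCubicJet g a' b' c') :
    HasCubicJet (fun t => (f t, g t)) (a, a') (b, b') (c, c') := by
  obtain ⟨k, hk, hfk⟩ := hf
  obtain ⟨l, hl, hgl⟩ := hg
  refine ⟨fun t => (k t, l t), hk.prodMk_nhds hl, ?_⟩
  filter_upwards [hfk, hgl] with t h1 h2
  simp [h1, h2]

theorem bilin {g : ℝ → Y} {a' b' c' : Y} (hf : HasCubicJet f a b c)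
    (hg : HasCubicJet g a' b' c') (B : X →L[ℝ] Y →L[ℝ] Z) :
    HasCubicJet (fun t => B (f t) (g t)) 0 (B a a') (B a b' + B b a') := by
  obtain ⟨k, hk, hfk⟩ := hf
  obtain ⟨l, hl, hgl⟩ := hg
  refine ⟨fun t => B a b' + B b a' + t • (B a (l t) + B b b' + B (k t) a') +
    t ^ 2 • (B b (l t) + B (k t) b') + t ^ 3 • B (k t) (l t), ?_, ?_⟩
  · have hid : Tendsto (fun t : ℝ => t) (𝓝 0) (𝓝 0) := tendsto_id
    have hB {p : ℝ → X} {q : ℝ → Y} {x : X} {y : Y} (hp : Tendsto p (𝓝 0) (𝓝 x))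
        (hq : Tendsto q (𝓝 0) (𝓝 y)) : Tendsto (fun t => B (p t) (q t)) (𝓝 0) (𝓝 (B x y)) :=
      (B.continuous₂.tendsto (x, y)).comp (hp.prodMk_nhds hq)
    have hX (x : X) : Tendsto (fun _ : ℝ => x) (𝓝 0) (𝓝 x) := tendsto_const_nhds
    have hY (y : Y) : Tendsto (fun _ : ℝ => y) (𝓝 0) (𝓝 y) := tendsto_const_nhds
    simpa using ((((hB (hX a) (hY b')).add (hB (hX b) (hY a'))).add
      (hid.smul (((hB (hX a) hl).add (hB (hX b) (hY b'))).add (hB hk (hY a'))))).add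
      ((hid.pow 2).smul ((hB (hX b) hl).add (hB hk (hY b'))))).add ((hid.pow 3).smul (hB hk hl))
  · filter_upwards [hfk, hgl] with t h1 h2
    rw [h1, h2]
    simp only [map_add, map_smul, add_apply, smul_apply]
    module

theorem isBigO (hf : HasCubicJet f a b c) : f =O[𝓝 0] (fun t : ℝ => t) := by
  obtain ⟨k, hk, hfk⟩ := hf
  have hid : Tendsto (fun t : ℝ => t) (𝓝 0) (𝓝 0) := tendsto_id
  have hquot : Tendsto (fun t : ℝ => a + t • b + t ^ 2 • k t) (𝓝 0) (𝓝 a) := by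
    simpa using ((tendsto_const_nhds (x := a)).add (hid.smul_const b)).add ((hid.pow 2).smul hk)
  refine ((Asymptotics.isBigO_refl (fun t : ℝ => t) (𝓝 0)).smul (hquot.isBigO_one ℝ)).congr' ?_
    (by simp)
  filter_upwards [hfk] with t ht
  rw [ht]; module

theorem tendsto_zero (hf : HasCubicJet f a b c) : Tendsto f (𝓝 0) (𝓝 0) :=
  hf.isBigO.trans_tendsto tendsto_id

theorem of_isLittleO (hf : f =o[𝓝 0] fun t : ℝ => t ^ 3) : HasCubicJet f 0 0 0 := by
  refine ⟨fun t => (t ^ 3)⁻¹ • f t, ?_, ?_⟩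
  · rw [tendsto_zero_iff_norm_tendsto_zero]
    simpa [norm_smul, div_eq_inv_mul] using hf.norm_left.tendsto_div_nhds_zero.norm
  · filter_upwards [hf.def one_pos] with t ht
    rcases eq_or_ne t 0 with rfl | h0
    · simpa using ht
    · simp [h0]

theorem eq_zero_of_eventually_eq_zero (hf : HasCubicJet f a b c) (h : ∀ᶠ t in 𝓝 0, f t = 0) :
    a = 0 ∧ b = 0 ∧ c = 0 := by
  obtain ⟨k, hk, hfk⟩ := hf
  have hid : Tendsto (fun t : ℝ => t) (𝓝[≠] 0) (𝓝 0) := tendsto_id.mono_left nhdsWithin_le_nhds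
  replace hk : Tendsto k (𝓝[≠] 0) (𝓝 c) := hk.mono_left nhdsWithin_le_nhds
  have h0 : ∀ᶠ t in 𝓝[≠] (0 : ℝ), t • a + t ^ 2 • b + t ^ 3 • k t = 0 := by
    filter_upwards [(hfk.and h).filter_mono nhdsWithin_le_nhds] with t ht
    rw [← ht.1, ht.2]
  have ha : a = 0 := by
    refine eq_zero_of_pow_smul_eventually_eq_zero (n := 1)
      (w := fun t => a + t • b + t ^ 2 • k t) ?_ ?_
    · simpa using ((tendsto_const_nhds (x := a)).add (hid.smul_const b)).add ((hid.pow 2).smul hk)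
    · filter_upwards [h0] with t ht
      rw [← ht]; module
  have hb : b = 0 := by
    refine eq_zero_of_pow_smul_eventually_eq_zero (n := 2) (w := fun t => b + t • k t) ?_ ?_
    · simpa using (tendsto_const_nhds (x := b)).add (hid.smul hk)
    · filter_upwards [h0] with t ht
      rw [← ht, ha]; module
  refine ⟨ha, hb, eq_zero_of_pow_smul_eventually_eq_zero (n := 3) hk ?_⟩
  filter_upwards [h0] with t ht
  rw [← ht, ha, hb]; module

theorem coeff_unique (hf : HasCubicJet f a b c) (hg : HasCubicJet f a' b' c') :
    a = a' ∧ b = b' ∧ c = c' := by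
  obtain ⟨ha, hb, hc⟩ := (hf.add (hg.smul (-1))).eq_zero_of_eventually_eq_zero
    (.of_forall fun t => by module)
  simp only [neg_smul, one_smul, ← sub_eq_add_neg, sub_eq_zero] at ha hb hc
  exact ⟨ha, hb, hc⟩

theorem comp_contDiffAt (hf : HasCubicJet f a b c) {F : X → Y} (hF : ContDiffAt ℝ 3 F 0)
    (h0 : F 0 = 0) :
    HasCubicJet (fun t => F (f t)) (fderiv ℝ F 0 a)
      (fderiv ℝ F 0 b + (1 / 2 : ℝ) • fderiv ℝ (fderiv ℝ F) 0 a a)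
      (fderiv ℝ F 0 c + fderiv ℝ (fderiv ℝ F) 0 a b +
        (1 / 6 : ℝ) • fderiv ℝ (fderiv ℝ (fderiv ℝ F)) 0 a a a) := by
  have hsymm := fderiv_fderiv_symm (hF.of_le (by norm_num)) a b
  have hT := taylor_three_isLittleO hF
  set F₁ := fderiv ℝ F 0
  set F₂ := fderiv ℝ (fderiv ℝ F) 0
  set F₃ := fderiv ℝ (fderiv ℝ (fderiv ℝ F)) 0
  have hrem : HasCubicJet (fun t => F (f t) - (F 0 + F₁ (f t) + (1 / 2 : ℝ) • F₂ (f t) (f t) +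
      (1 / 6 : ℝ) • F₃ (f t) (f t) (f t))) 0 0 0 :=
    of_isLittleO ((hT.comp_tendsto hf.tendsto_zero).trans_isBigO (hf.isBigO.norm_left.pow 3))
  have hcubic := ((hf.bilin hf F₃).bilin hf (ContinuousLinearMap.id ℝ (X →L[ℝ] Y))).smul
    (1 / 6 : ℝ)
  have hsum := ((hrem.add (hf.clm F₁)).add ((hf.bilin hf F₂).smul (1 / 2 : ℝ))).add hcubic
  refine (hsum.congr' (.of_forall fun t => ?_)).congr_coeff ?_ ?_ ?_
  · simp only [h0, ContinuousLinearMap.coe_id', id_eq]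
    abel
  · simp
  · simp
  · simp only [hsymm, ContinuousLinearMap.coe_id', id_eq, zero_apply, zero_add]
    module

end HasCubicJet

theorem exists_hasCubicJet_comp {F : X → Y} (hF : ContDiffAt ℝ 3 F 0) (h0 : F 0 = 0)
    {f : ℝ → X} {a b c : X} (hf : HasCubicJet f a b c) :
    ∃ a' b' c', HasCubicJet (fun t => F (f t)) a' b' c' :=
  ⟨_, _, _, hf.comp_contDiffAt hF h0⟩

end Jets

section SmoothGerms

variable {X Y Z : Type*} [NormedAddCommGroup X] [NormedSpace ℝ X]
  [NormedAddCommGroup Y] [NormedSpace ℝ Y] [NormedAddCommGroup Z] [NormedSpace ℝ Z]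

/-- A germ at `0` of a smooth map sending `0` to `0`. -/
structure IsSmoothGerm (f : X → Y) : Prop where
  contDiffAt : ContDiffAt ℝ ∞ f 0
  map_zero : f 0 = 0

namespace IsSmoothGerm

theorem tendsto {f : X → Y} (hf : IsSmoothGerm f) : Tendsto f (𝓝 0) (𝓝 0) := by
  simpa only [hf.map_zero] using hf.contDiffAt.continuousAt.tendsto

theorem hasFDerivAt {f : X → Y} (hf : IsSmoothGerm f) : HasFDerivAt f (fderiv ℝ f 0) 0 :=
  (hf.contDiffAt.differentiableAt (by simp)).hasFDerivAt

theorem congr' {f g : X → Y} (hf : IsSmoothGerm f) (h : g =ᶠ[𝓝 0] f) : IsSmoothGerm g :=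
  ⟨hf.contDiffAt.congr_of_eventuallyEq h, h.self_of_nhds.trans hf.map_zero⟩

theorem of_clm (L : X →L[ℝ] Y) : IsSmoothGerm L :=
  ⟨L.contDiff.contDiffAt, L.map_zero⟩

theorem comp {g : Y → Z} {f : X → Y} (hg : IsSmoothGerm g) (hf : IsSmoothGerm f) :
    IsSmoothGerm fun x => g (f x) :=
  ⟨ContDiffAt.comp (0 : X) (hf.map_zero.symm ▸ hg.contDiffAt) hf.contDiffAt,
    (congr_arg g hf.map_zero).trans hg.map_zero⟩

theorem prodMk {f : X → Y} {g : X → Z} (hf : IsSmoothGerm f) (hg : IsSmoothGerm g) :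
    IsSmoothGerm fun x => (f x, g x) :=
  ⟨hf.contDiffAt.prodMk hg.contDiffAt, Prod.ext hf.map_zero hg.map_zero⟩

theorem add {f g : X → Y} (hf : IsSmoothGerm f) (hg : IsSmoothGerm g) :
    IsSmoothGerm fun x => f x + g x :=
  ⟨hf.contDiffAt.add hg.contDiffAt, by rw [hf.map_zero, hg.map_zero, add_zero]⟩

end IsSmoothGerm

theorem exists_local_inverse [CompleteSpace X] {f : X → Y} (hf : IsSmoothGerm f) {e : X ≃L[ℝ] Y}
    (he : HasFDerivAt f (e : X →L[ℝ] Y) 0) :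
    ∃ g : Y → X, IsSmoothGerm g ∧ HasFDerivAt g (e.symm : Y →L[ℝ] X) 0 ∧
      (∀ᶠ x in 𝓝 0, g (f x) = x) ∧ ∀ᶠ y in 𝓝 0, f (g y) = y := by
  have hstrict := hf.contDiffAt.hasStrictFDerivAt' he (by simp)
  have hsmooth := hf.contDiffAt.to_localInverse he (by simp)
  have hzero := hf.contDiffAt.localInverse_apply_image he (by simp)
  have hderiv := hstrict.to_localInverse.hasFDerivAt
  have hright := hstrict.eventually_right_inverse
  rw [hf.map_zero] at hsmooth hzero hderiv hright
  exact ⟨_, ⟨hsmooth, hzero⟩, hderiv, hstrict.eventually_left_inverse, hright⟩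

end SmoothGerms

section UnitalJets

theorem prodMk_eq_inl_add_inr {M N : Type*} [AddZeroClass M] [AddZeroClass N] (x : M) (y : N) :
    (x, y) = (x, 0) + (0, y) :=
  (Prod.fst_add_snd (x, y)).symm

variable {X W Z : Type*} [NormedAddCommGroup X] [NormedSpace ℝ X]
  [NormedAddCommGroup W] [NormedSpace ℝ W] [NormedAddCommGroup Z] [NormedSpace ℝ Z]

theorem eventually_smul {p : X → Prop} (h : ∀ᶠ x in 𝓝 0, p x) (x : X) :
    ∀ᶠ t in 𝓝 (0 : ℝ), p (t • x) :=
  (HasCubicJet.line x).tendsto_zero.eventually h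

theorem bilin_eq_zero_of_symm_of_diag {T : X →L[ℝ] X →L[ℝ] Z} (hsymm : ∀ x y, T x y = T y x)
    (hdiag : ∀ x, T x x = 0) (x y : X) : T x y = 0 := by
  have h := hdiag (x + y)
  simp only [map_add, add_apply, hdiag, hsymm y x] at h
  linear_combination (norm := module) (1 / 2 : ℝ) • h

theorem trilin_cyclic_eq_zero_of_diag {T : X →L[ℝ] X →L[ℝ] X →L[ℝ] Z} (hdiag : ∀ x, T x x x = 0)
    (x z : X) : T x x z + T x z x + T z x x = 0 := by
  have hadd := hdiag (x + z)
  have hsub := hdiag (x - z)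
  simp only [map_add, map_sub, add_apply, sub_apply, hdiag] at hadd hsub
  linear_combination (norm := module) (1 / 2 : ℝ) • hadd - (1 / 2 : ℝ) • hsub

theorem fderivs_apply_of_comp_eq_id {F : W → X} (hF : ContDiffAt ℝ 3 F 0) {L : X →L[ℝ] W}
    (hL : ∀ᶠ x in 𝓝 0, F (L x) = x) (x : X) : fderiv ℝ F 0 (L x) = x ∧
      fderiv ℝ (fderiv ℝ F) 0 (L x) (L x) = 0 ∧
      fderiv ℝ (fderiv ℝ (fderiv ℝ F)) 0 (L x) (L x) (L x) = 0 := by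
  have h0 : F 0 = 0 := by simpa using hL.self_of_nhds
  have hcomp := (HasCubicJet.line (L x)).comp_contDiffAt hF h0
  have hline := (HasCubicJet.line x).congr' (g := fun t => F (t • L x)) (by
    filter_upwards [eventually_smul hL x] with t ht
    rw [← map_smul, ht])
  obtain ⟨h₁, h₂, h₃⟩ := hcomp.coeff_unique hline
  simp only [map_zero, zero_add] at h₁ h₂ h₃
  exact ⟨h₁, (smul_eq_zero.1 h₂).resolve_left (by norm_num),
    (smul_eq_zero.1 h₃).resolve_left (by norm_num)⟩

/-- A germ at `(0, 0)` of a smooth binary operation with unit `0`. -/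
structure IsUnitalGerm (F : X × X → X) : Prop where
  contDiffAt : ContDiffAt ℝ ∞ F 0
  right_unit : ∀ᶠ x in 𝓝 (0 : X), F (x, 0) = x
  left_unit : ∀ᶠ y in 𝓝 (0 : X), F (0, y) = y

/-- Precomposition of a trilinear map with three linear maps, the trilinear analogue of
`ContinuousLinearMap.bilinearComp`. -/
def trilinearComp (T : W →L[ℝ] W →L[ℝ] W →L[ℝ] Z) (f g h : X →L[ℝ] W) :
    X →L[ℝ] X →L[ℝ] X →L[ℝ] Z :=
  ((ContinuousLinearMap.compL ℝ X W (X →L[ℝ] Z)).flip g).comp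
    ((ContinuousLinearMap.compL ℝ W (W →L[ℝ] Z) (X →L[ℝ] Z)
      ((ContinuousLinearMap.compL ℝ X W Z).flip h)).comp (T.comp f))

/-- The mixed second derivative `∂²F/∂x∂y` at `(0, 0)`. -/
def mixedXY (F : X × X → Z) : X →L[ℝ] X →L[ℝ] Z :=
  (fderiv ℝ (fderiv ℝ F) 0).bilinearComp (.inl ℝ X X) (.inr ℝ X X)

/-- The mixed third derivative `∂³F/∂x∂x∂y` at `(0, 0)`. -/
def mixedXXY (F : X × X → Z) : X →L[ℝ] X →L[ℝ] X →L[ℝ] Z :=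
  trilinearComp (fderiv ℝ (fderiv ℝ (fderiv ℝ F)) 0) (.inl ℝ X X) (.inl ℝ X X) (.inr ℝ X X)

/-- The mixed third derivative `∂³F/∂x∂y∂y` at `(0, 0)`. -/
def mixedXYY (F : X × X → Z) : X →L[ℝ] X →L[ℝ] X →L[ℝ] Z :=
  trilinearComp (fderiv ℝ (fderiv ℝ (fderiv ℝ F)) 0) (.inl ℝ X X) (.inr ℝ X X) (.inr ℝ X X)

theorem mixedXY_apply (F : X × X → Z) (x y : X) :
    mixedXY F x y = fderiv ℝ (fderiv ℝ F) 0 (x, 0) (0, y) := rfl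

theorem mixedXXY_apply (F : X × X → Z) (x y z : X) :
    mixedXXY F x y z = fderiv ℝ (fderiv ℝ (fderiv ℝ F)) 0 (x, 0) (y, 0) (0, z) := rfl

theorem mixedXYY_apply (F : X × X → Z) (x y z : X) :
    mixedXYY F x y z = fderiv ℝ (fderiv ℝ (fderiv ℝ F)) 0 (x, 0) (0, y) (0, z) := rfl

namespace IsUnitalGerm

variable {F : X × X → X}

theorem map_zero (hF : IsUnitalGerm F) : F 0 = 0 :=
  hF.right_unit.self_of_nhds

theorem isSmoothGerm (hF : IsUnitalGerm F) : IsSmoothGerm F :=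
  ⟨hF.contDiffAt, hF.map_zero⟩

theorem contDiffAt_three (hF : IsUnitalGerm F) : ContDiffAt ℝ 3 F 0 :=
  hF.contDiffAt.of_le ENat.LEInfty.out

theorem contDiffAt_two (hF : IsUnitalGerm F) : ContDiffAt ℝ 2 F 0 :=
  hF.contDiffAt.of_le ENat.LEInfty.out

theorem mixedXXY_symm (hF : IsUnitalGerm F) (x y z : X) :
    mixedXXY F x y z = mixedXXY F y x z :=
  fderiv_fderiv_fderiv_symm_left hF.contDiffAt_three _ _ _

theorem mixedXYY_symm (hF : IsUnitalGerm F) (x y z : X) :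
    mixedXYY F x y z = mixedXYY F x z y :=
  fderiv_fderiv_fderiv_symm_right hF.contDiffAt_three _ _ _

theorem fderivs_inl (hF : IsUnitalGerm F) (x : X) : fderiv ℝ F 0 (x, 0) = x ∧
    fderiv ℝ (fderiv ℝ F) 0 (x, 0) (x, 0) = 0 ∧
    fderiv ℝ (fderiv ℝ (fderiv ℝ F)) 0 (x, 0) (x, 0) (x, 0) = 0 :=
  fderivs_apply_of_comp_eq_id (L := .inl ℝ X X) hF.contDiffAt_three hF.right_unit x

theorem fderivs_inr (hF : IsUnitalGerm F) (y : X) : fderiv ℝ F 0 (0, y) = y ∧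
    fderiv ℝ (fderiv ℝ F) 0 (0, y) (0, y) = 0 ∧
    fderiv ℝ (fderiv ℝ (fderiv ℝ F)) 0 (0, y) (0, y) (0, y) = 0 :=
  fderivs_apply_of_comp_eq_id (L := .inr ℝ X X) hF.contDiffAt_three hF.left_unit y

theorem fderiv_apply (hF : IsUnitalGerm F) (x y : X) : fderiv ℝ F 0 (x, y) = x + y := by
  rw [prodMk_eq_inl_add_inr, map_add, (hF.fderivs_inl x).1, (hF.fderivs_inr y).1]

theorem fderiv_fderiv_apply (hF : IsUnitalGerm F) (x y x' y' : X) :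
    fderiv ℝ (fderiv ℝ F) 0 (x, y) (x', y') = mixedXY F x y' + mixedXY F x' y := by
  have hsymm := fderiv_fderiv_symm hF.contDiffAt_two
  set T := fderiv ℝ (fderiv ℝ F) 0 with hT
  have hxx : T (x, 0) (x', 0) = 0 :=
    bilin_eq_zero_of_symm_of_diag (T := T.bilinearComp (.inl ℝ X X) (.inl ℝ X X))
      (fun _ _ => hsymm _ _) (fun u => (hF.fderivs_inl u).2.1) x x'
  have hyy : T (0, y) (0, y') = 0 :=
    bilin_eq_zero_of_symm_of_diag (T := T.bilinearComp (.inr ℝ X X) (.inr ℝ X X))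
      (fun _ _ => hsymm _ _) (fun u => (hF.fderivs_inr u).2.1) y y'
  rw [prodMk_eq_inl_add_inr x, prodMk_eq_inl_add_inr x', mixedXY_apply, mixedXY_apply, ← hT,
    hsymm (x', 0) (0, y)]
  simp only [map_add, add_apply, hxx, hyy, zero_add, add_comm]

theorem fderiv_fderiv_fderiv_apply (hF : IsUnitalGerm F) (x y : X) :
    fderiv ℝ (fderiv ℝ (fderiv ℝ F)) 0 (x, y) (x, y) (x, y) =
      (3 : ℝ) • mixedXXY F x x y + (3 : ℝ) • mixedXYY F x y y := by
  have hl := fderiv_fderiv_fderiv_symm_left hF.contDiffAt_three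
  have hr := fderiv_fderiv_fderiv_symm_right hF.contDiffAt_three
  have hxxx := (hF.fderivs_inl x).2.2
  have hyyy := (hF.fderivs_inr y).2.2
  rw [mixedXXY_apply, mixedXYY_apply]
  set T := fderiv ℝ (fderiv ℝ (fderiv ℝ F)) 0
  rw [prodMk_eq_inl_add_inr x y]
  simp only [map_add, add_apply, hxxx, hyyy]
  rw [hr (x, 0) (0, y) (x, 0), hl (0, y) (x, 0) (x, 0), hr (x, 0) (0, y) (x, 0),
    hr (0, y) (0, y) (x, 0), hl (0, y) (x, 0) (0, y)]
  module

theorem hasCubicJet (hF : IsUnitalGerm F) {u v : ℝ → X} {a b c a' b' c' : X}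
    (hu : HasCubicJet u a b c) (hv : HasCubicJet v a' b' c') :
    HasCubicJet (fun t => F (u t, v t)) (a + a') (b + b' + mixedXY F a a')
      (c + c' + mixedXY F a b' + mixedXY F b a' + (1 / 2 : ℝ) • mixedXXY F a a a' +
        (1 / 2 : ℝ) • mixedXYY F a a' a') := by
  refine ((hu.prodMk hv).comp_contDiffAt hF.contDiffAt_three hF.map_zero).congr_coeff ?_ ?_ ?_
  · rw [hF.fderiv_apply]
  · rw [hF.fderiv_apply, hF.fderiv_fderiv_apply]
    module
  · rw [hF.fderiv_apply, hF.fderiv_fderiv_apply, hF.fderiv_fderiv_fderiv_apply]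
    module

theorem assoc_mixed (hF : IsUnitalGerm F)
    (hassoc : ∀ᶠ p : X × X × X in 𝓝 0, F (F (p.1, p.2.1), p.2.2) = F (p.1, F (p.2.1, p.2.2)))
    (x y z : X) : mixedXY F (mixedXY F x y) z + mixedXXY F x y z =
      mixedXY F x (mixedXY F y z) + mixedXYY F x y z := by
  have hx := HasCubicJet.line x
  have hy := HasCubicJet.line y
  have hz := HasCubicJet.line z
  have hleft := (hF.hasCubicJet (hF.hasCubicJet hx hy) hz).congr' (eventually_smul hassoc (x, y, z))
  have hcubic := (hleft.coeff_unique (hF.hasCubicJet hx (hF.hasCubicJet hy hz))).2.2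
  simp only [map_add, add_apply, _root_.map_zero, zero_apply, zero_add, add_zero] at hcubic
  rw [hF.mixedXXY_symm y x z, hF.mixedXYY_symm x z y] at hcubic
  linear_combination (norm := module) hcubic

theorem doubling_mixed (hF : IsUnitalGerm F) (hdouble : ∀ᶠ x in 𝓝 (0 : X), F (x, x) = (2 : ℝ) • x)
    (x : X) : mixedXY F x x = 0 ∧ mixedXXY F x x x + mixedXYY F x x x = 0 := by
  have hx := HasCubicJet.line x
  obtain ⟨-, hquad, hcubic⟩ :=
    ((hF.hasCubicJet hx hx).congr' (eventually_smul hdouble x)).coeff_unique (hx.smul 2)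
  simp only [_root_.map_zero, zero_apply, zero_add, smul_zero] at hquad hcubic
  refine ⟨hquad, ?_⟩
  linear_combination (norm := module) (2 : ℝ) • hcubic

end IsUnitalGerm

/-- A germ of a local group law, written in coordinates in which the lines through `0` are
one-parameter subgroups. Only doubling along these lines is recorded, which is all that the third
order expansion needs. -/
structure IsNormalGroupGerm (F : X × X → X) : Prop extends IsUnitalGerm F where
  assoc : ∀ᶠ p : X × X × X in 𝓝 0, F (F (p.1, p.2.1), p.2.2) = F (p.1, F (p.2.1, p.2.2))
  double : ∀ᶠ x in 𝓝 (0 : X), F (x, x) = (2 : ℝ) • x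

namespace IsNormalGroupGerm

variable {F : X × X → X}

theorem mixedXY_self (hF : IsNormalGroupGerm F) (x : X) : mixedXY F x x = 0 :=
  (hF.doubling_mixed hF.double x).1

theorem mixedXY_antisymm (hF : IsNormalGroupGerm F) (x y : X) :
    mixedXY F x y = -mixedXY F y x := by
  have h := hF.mixedXY_self (x + y)
  simp only [map_add, add_apply, hF.mixedXY_self] at h
  linear_combination (norm := module) h

theorem mixedXXY_mixedXYY_self (hF : IsNormalGroupGerm F) (x : X) :
    mixedXXY F x x x = 0 ∧ mixedXYY F x x x = 0 := by
  have hdouble := (hF.doubling_mixed hF.double x).2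
  have hassoc := hF.assoc_mixed hF.assoc x x x
  simp only [hF.mixedXY_self, map_zero, zero_apply, zero_add] at hassoc
  constructor
  · linear_combination (norm := module) (1 / 2 : ℝ) • hdouble + (1 / 2 : ℝ) • hassoc
  · linear_combination (norm := module) (1 / 2 : ℝ) • hdouble - (1 / 2 : ℝ) • hassoc

theorem mixedXXY_mixedXYY_diag (hF : IsNormalGroupGerm F) (x z : X) :
    mixedXXY F x x z = (2 / 3 : ℝ) • mixedXY F x (mixedXY F x z) ∧
    mixedXYY F z x x = (2 / 3 : ℝ) • mixedXY F x (mixedXY F x z) := by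
  have hXXY := trilin_cyclic_eq_zero_of_diag (fun x => (hF.mixedXXY_mixedXYY_self x).1) x z
  have hXYY := trilin_cyclic_eq_zero_of_diag (fun x => (hF.mixedXXY_mixedXYY_self x).2) x z
  have hxxz := hF.assoc_mixed hF.assoc x x z
  have hxzx := hF.assoc_mixed hF.assoc x z x
  rw [hF.mixedXXY_symm z x] at hXXY
  rw [hF.mixedXYY_symm x z x] at hXYY
  rw [hF.mixedXY_self, map_zero, zero_apply] at hxxz
  rw [hF.mixedXY_antisymm (mixedXY F x z) x, hF.mixedXY_antisymm z x, map_neg,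
    hF.mixedXYY_symm x z x] at hxzx
  constructor
  · linear_combination (norm := module)
      (2 / 3 : ℝ) • hxxz - (2 / 3 : ℝ) • hxzx + (1 / 3 : ℝ) • hXXY
  · linear_combination (norm := module)
      (2 / 3 : ℝ) • hxxz + (4 / 3 : ℝ) • hxzx - (2 / 3 : ℝ) • hXXY + hXYY

theorem mixedXXY_eq (hF : IsNormalGroupGerm F) (x y z : X) : mixedXXY F x y z =
    (1 / 3 : ℝ) • (mixedXY F x (mixedXY F y z) + mixedXY F y (mixedXY F x z)) := by
  have h := (hF.mixedXXY_mixedXYY_diag (x + y) z).1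
  simp only [map_add, add_apply, (hF.mixedXXY_mixedXYY_diag _ _).1, hF.mixedXXY_symm y x] at h
  linear_combination (norm := module) (1 / 2 : ℝ) • h

theorem mixedXYY_eq (hF : IsNormalGroupGerm F) (x y z : X) : mixedXYY F x y z =
    (1 / 3 : ℝ) • (mixedXY F y (mixedXY F z x) + mixedXY F z (mixedXY F y x)) := by
  have h := (hF.mixedXXY_mixedXYY_diag (y + z) x).2
  simp only [map_add, add_apply, (hF.mixedXXY_mixedXYY_diag _ _).2, hF.mixedXYY_symm x z y] at h
  linear_combination (norm := module) (1 / 2 : ℝ) • h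

theorem jacobi (hF : IsNormalGroupGerm F) (x y z : X) : mixedXY F y (mixedXY F x z) =
    mixedXY F x (mixedXY F y z) + mixedXY F z (mixedXY F x y) := by
  have h := hF.assoc_mixed hF.assoc x y z
  rw [hF.mixedXXY_eq, hF.mixedXYY_eq, hF.mixedXY_antisymm (mixedXY F x y) z,
    hF.mixedXY_antisymm z x, hF.mixedXY_antisymm y x, map_neg, map_neg] at h
  linear_combination (norm := module) (3 / 2 : ℝ) • h

end IsNormalGroupGerm

end UnitalJets

section Nemytskii

universe u

variable {K : Type*} [TopologicalSpace K] [CompactSpace K]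

section

variable {E F : Type*} [NormedAddCommGroup E] [NormedSpace ℝ E]
  [NormedAddCommGroup F] [NormedSpace ℝ F]

/-- Pointwise application of a continuous family of linear maps to a continuous map. -/
def pointwiseApply : C(K, E →L[ℝ] F) →L[ℝ] C(K, E) →L[ℝ] C(K, F) :=
  LinearMap.mkContinuous₂
    (LinearMap.mk₂ ℝ (fun (A : C(K, E →L[ℝ] F)) (h : C(K, E)) =>
      (⟨fun t => A t (h t), by fun_prop⟩ : C(K, F)))
      (fun A A' h => by ext; simp) (fun c A h => by ext; simp)
      (fun A h h' => by ext; simp) (fun c A h => by ext; simp)) 1 (fun A h => by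
      rw [one_mul, ContinuousMap.norm_le _ (by positivity)]
      intro t
      exact (A t).le_of_opNorm_le_of_le (A.norm_coe_le_norm t) (h.norm_coe_le_norm t))

theorem hasFDerivAt_postcomp {f : C(E, F)} (hf : Differentiable ℝ f)
    {f' : C(E, E →L[ℝ] F)} (hf' : ∀ x, fderiv ℝ f x = f' x) (γ : C(K, E)) :
    HasFDerivAt (fun γ : C(K, E) => f.comp γ) (pointwiseApply (f'.comp γ)) γ := by
  rw [hasFDerivAt_iff_isLittleO_nhds_zero, Asymptotics.isLittleO_iff]
  intro ε hε
  obtain ⟨δ, hδ, hball⟩ := Metric.eventually_nhds_iff.1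
    (((f'.continuous_postcomp (X := K)).tendsto γ).eventually_mem
      (Metric.closedBall_mem_nhds (f'.comp γ) hε))
  filter_upwards [Metric.ball_mem_nhds (0 : C(K, E)) hδ] with h hh
  have hhδ : ‖h‖ < δ := by simpa using hh
  rw [ContinuousMap.norm_le _ (by positivity)]
  intro t
  have hclose : ∀ z ∈ segment ℝ (γ t) (γ t + h t), ‖fderiv ℝ f z - f' (γ t)‖ ≤ ε := by
    rw [segment_eq_image']
    rintro _ ⟨s, hs, rfl⟩
    have hdist : dist (γ + s • h) γ < δ := by
      rw [dist_eq_norm, add_sub_cancel_left, norm_smul, Real.norm_of_nonneg hs.1]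
      exact (mul_le_of_le_one_left (norm_nonneg _) hs.2).trans_lt hhδ
    have hdist' :=
      (ContinuousMap.dist_apply_le_dist t).trans (Metric.mem_closedBall.1 (hball hdist))
    simpa [hf', dist_eq_norm] using hdist'
  have hmvt := Convex.norm_image_sub_le_of_norm_fderiv_le' (𝕜 := ℝ) (fun z _ => hf z) hclose
    (convex_segment _ _) (left_mem_segment ℝ _ _) (right_mem_segment ℝ _ _)
  rw [add_sub_cancel_left] at hmvt
  exact hmvt.trans (mul_le_mul_of_nonneg_left (h.norm_coe_le_norm t) hε.le)

end

theorem contDiff_postcomp_nat {E : Type u} [NormedAddCommGroup E] [NormedSpace ℝ E]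
    (n : ℕ) : ∀ {F : Type u} [NormedAddCommGroup F] [NormedSpace ℝ F] (f : C(E, F)),
      ContDiff ℝ n f → ContDiff ℝ n (fun γ : C(K, E) => f.comp γ) := by
  induction n with
  | zero =>
    intro F _ _ f _
    simpa using! f.continuous_postcomp (X := K)
  | succ n ih =>
    intro F _ _ f hf
    rw [Nat.cast_succ] at hf ⊢
    have hfderiv := (contDiff_succ_iff_fderiv.1 hf).2.2
    let f' : C(E, E →L[ℝ] F) := ⟨fderiv ℝ f, hfderiv.continuous⟩
    rw [contDiff_succ_iff_hasFDerivAt]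
    refine ⟨fun γ => pointwiseApply (f'.comp γ), ?_, fun γ => ?_⟩
    · exact pointwiseApply.contDiff.comp (ih f' hfderiv)
    · exact hasFDerivAt_postcomp (hf.differentiable (by simp)) (fun _ => rfl) γ

theorem contDiff_postcomp {E F : Type u} [NormedAddCommGroup E] [NormedSpace ℝ E]
    [NormedAddCommGroup F] [NormedSpace ℝ F] (f : C(E, F)) (hf : ContDiff ℝ ∞ f) :
    ContDiff ℝ ∞ (fun γ : C(K, E) => f.comp γ) := by
  rw [contDiff_infty] at hf ⊢
  exact fun n => contDiff_postcomp_nat n f (hf n)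

end Nemytskii

section Flow

open unitInterval

variable {E : Type*} [NormedAddCommGroup E] [NormedSpace ℝ E]

theorem exists_contDiff_eventuallyEq {F : Type*} [FiniteDimensional ℝ E] [NormedAddCommGroup F]
    [NormedSpace ℝ F] {f : E → F} {s : Set E} {x : E} (hs : s ∈ 𝓝 x) (hf : ContDiffOn ℝ ∞ f s) :
    ∃ g : E → F, ContDiff ℝ ∞ g ∧ g =ᶠ[𝓝 x] f := by
  obtain ⟨r, hr, hrs⟩ := Metric.nhds_basis_closedBall.mem_iff.1 (interior_mem_nhds.2 hs)
  let χ : ContDiffBump x := ⟨r / 2, r, by positivity, by linarith⟩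
  refine ⟨fun y => χ y • f y, ?_, ?_⟩
  · rw [contDiff_iff_contDiffAt]
    intro y
    by_cases hy : y ∈ tsupport χ
    · have hy' : y ∈ interior s := hrs (by simpa [χ.tsupport_eq] using hy)
      exact χ.contDiff.contDiffAt.smul (hf.contDiffAt (mem_interior_iff_mem_nhds.1 hy'))
    · refine (contDiffAt_const (c := (0 : F))).congr_of_eventuallyEq ?_
      filter_upwards [(isClosed_tsupport χ).isOpen_compl.mem_nhds hy] with z hz
      simp [image_eq_zero_of_notMem_tsupport hz]
  · filter_upwards [χ.eventuallyEq_one] with y hy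
    simp [hy]

theorem hasFDerivAt_fst_of_eventually {f : E × E → E} (hf : DifferentiableAt ℝ f 0)
    (hfst : ∀ᶠ x in 𝓝 (0 : E), f (x, 0) = x) (hsnd : ∀ᶠ y in 𝓝 (0 : E), f (0, y) = 0) :
    HasFDerivAt f (.fst ℝ E E) 0 := by
  have hinl := HasFDerivAt.comp (0 : E) (f := ContinuousLinearMap.inl ℝ E E)
    hf.hasFDerivAt (ContinuousLinearMap.inl ℝ E E).hasFDerivAt
  have hinr := HasFDerivAt.comp (0 : E) (f := ContinuousLinearMap.inr ℝ E E)
    hf.hasFDerivAt (ContinuousLinearMap.inr ℝ E E).hasFDerivAt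
  refine hf.hasFDerivAt.congr_fderiv (ContinuousLinearMap.ext fun p => ?_)
  have hx := DFunLike.congr_fun
    (hinl.unique ((hasFDerivAt_id (𝕜 := ℝ) (0 : E)).congr_of_eventuallyEq hfst)) p.1
  have hy := DFunLike.congr_fun
    (hinr.unique ((hasFDerivAt_const (𝕜 := ℝ) (0 : E) (0 : E)).congr_of_eventuallyEq hsnd)) p.2
  calc fderiv ℝ f 0 p = fderiv ℝ f 0 (p.1, 0) + fderiv ℝ f 0 (0, p.2) := by
        rw [← map_add, Prod.fst_add_snd]
    _ = p.1 + 0 := congr_arg₂ (· + ·) hx hy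
    _ = p.1 := add_zero _

theorem exists_isSmoothGerm_fixedPoint {B : Type*} [NormedAddCommGroup B] [NormedSpace ℝ B]
    [CompleteSpace E] [CompleteSpace B] {Φ : E × B → B} (hΦ : IsSmoothGerm Φ)
    {M : E →L[ℝ] B} (hM : HasFDerivAt Φ (M.comp (.fst ℝ E B)) 0) :
    ∃ c : E → B, IsSmoothGerm c ∧ HasFDerivAt c M 0 ∧ ∀ᶠ ξ in 𝓝 0, Φ (ξ, c ξ) = c ξ := by
  let shear (L : E →L[ℝ] B) : E × B →L[ℝ] E × B :=
    (ContinuousLinearMap.fst ℝ E B).prod (.snd ℝ E B - L.comp (.fst ℝ E B))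
  let e : (E × B) ≃L[ℝ] E × B :=
    ContinuousLinearEquiv.equivOfInverse (shear M) (shear (-M)) (fun p => by simp [shear])
      (fun p => by simp [shear])
  obtain ⟨g, hg, hDg, -, hright⟩ := exists_local_inverse
    (f := fun p : E × B => (p.1, p.2 - Φ p)) (e := e)
    ⟨contDiffAt_fst.prodMk (contDiffAt_snd.sub hΦ.contDiffAt), by simp [hΦ.map_zero]⟩
    (hasFDerivAt_fst.prodMk (hasFDerivAt_snd.fun_sub hM))
  have hinl := (ContinuousLinearMap.inl ℝ E B).hasFDerivAt (x := 0)
  refine ⟨fun ξ => (g (ξ, 0)).2,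
    (IsSmoothGerm.of_clm (.snd ℝ E B)).comp (hg.comp (.of_clm (.inl ℝ E B))), ?_, ?_⟩
  · refine (hasFDerivAt_snd.comp (0 : E) (HasFDerivAt.comp (0 : E) hDg hinl)).congr_fderiv ?_
    refine ContinuousLinearMap.ext fun ξ => ?_
    change ((shear (-M)) (ξ, 0)).2 = M ξ
    simp [shear]
  · filter_upwards [hinl.continuousAt.tendsto.eventually hright] with ξ hξ
    obtain ⟨hfst, hsnd⟩ := Prod.ext_iff.1 hξ
    calc Φ (ξ, (g (ξ, 0)).2) = Φ (g (ξ, 0)) := congr_arg Φ (Prod.ext hfst.symm rfl)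
      _ = (g (ξ, 0)).2 := (sub_eq_zero.1 hsnd).symm

/-- The primitive vanishing at `0` of a continuous function on `[0, 1]`. -/
def primitiveL : C(I, E) →L[ℝ] C(I, E) :=
  LinearMap.mkContinuous
    { toFun := fun γ => ⟨fun t => ∫ s in (0 : ℝ)..t, IccExtend zero_le_one γ s,
        (intervalIntegral.continuous_primitive
          (fun a b => γ.continuous.Icc_extend'.intervalIntegrable a b) 0).comp
          continuous_subtype_val⟩
      map_add' := fun γ η => by
        have hint (γ : C(I, E)) (t : I) : IntervalIntegrable (IccExtend zero_le_one γ)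
            MeasureTheory.volume 0 t := γ.continuous.Icc_extend'.intervalIntegrable _ _
        ext t
        simpa [IccExtend] using intervalIntegral.integral_add (hint γ t) (hint η t)
      map_smul' := fun c γ => by
        ext t
        simp [IccExtend] } 1 (fun γ => by
      rw [one_mul, ContinuousMap.norm_le _ (by positivity)]
      intro t
      have := intervalIntegral.norm_integral_le_of_norm_le_const (a := 0) (b := (t : ℝ))
        (f := IccExtend zero_le_one γ) (C := ‖γ‖) (fun s _ => γ.norm_coe_le_norm _)
      refine this.trans ?_
      rw [sub_zero, abs_of_nonneg t.2.1]
      exact mul_le_of_le_one_right (norm_nonneg _) t.2.2)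

theorem primitiveL_apply (γ : C(I, E)) (t : I) :
    primitiveL γ t = ∫ s in (0 : ℝ)..t, IccExtend zero_le_one γ s := rfl

theorem hasDerivWithinAt_primitiveL (γ : C(I, E)) [CompleteSpace E] {t : ℝ} (ht : t ∈ I) :
    HasDerivWithinAt (IccExtend zero_le_one (primitiveL γ)) (γ ⟨t, ht⟩) I t := by
  have hd := (γ.continuous.Icc_extend' (h := zero_le_one)).integral_hasStrictDerivAt 0 t
  rw [IccExtend_of_mem _ _ ht] at hd
  refine hd.hasDerivAt.hasDerivWithinAt.congr_of_mem (fun s hs => ?_) ht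
  rw [IccExtend_of_mem _ _ hs, primitiveL_apply]

/-- A pair `(ξ, γ)`, seen as the curve `t ↦ (ξ, γ t)`. -/
def constProdL : E × C(I, E) →L[ℝ] C(I, E × E) :=
  LinearMap.mkContinuous
    { toFun := fun p => ⟨fun t => (p.1, p.2 t), by fun_prop⟩
      map_add' := fun p q => by ext <;> simp
      map_smul' := fun c p => by ext <;> simp } 1 (fun p => by
      rw [one_mul, ContinuousMap.norm_le _ (by positivity)]
      intro t
      exact max_le_max le_rfl (p.2.norm_coe_le_norm t))

/-- The Picard operator `(ξ, γ) ↦ ∫₀ᵗ Y (ξ, γ)` of the parametrised vector field `Y (ξ, ·)`: its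
fixed points `γ` are the integral curves of `Y (ξ, ·)` issued from `0`. -/
def picard (Y : C(E × E, E)) (p : E × C(I, E)) : C(I, E) := primitiveL (Y.comp (constProdL p))

theorem contDiff_picard {Y : C(E × E, E)} (hY : ContDiff ℝ ∞ Y) : ContDiff ℝ ∞ (picard Y) :=
  (primitiveL (E := E)).contDiff.comp
    ((contDiff_postcomp Y hY).comp (constProdL (E := E)).contDiff)

theorem hasFDerivAt_picard {Y : C(E × E, E)} (hY : ContDiff ℝ ∞ Y)
    (hY' : HasFDerivAt Y (.fst ℝ E E) 0) :
    HasFDerivAt (picard Y)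
      ((primitiveL.comp (ContinuousLinearMap.const ℝ I)).comp (.fst ℝ E C(I, E))) 0 := by
  let Y' : C(E × E, E × E →L[ℝ] E) := ⟨fderiv ℝ Y, hY.continuous_fderiv (by simp)⟩
  have hpost := (hasFDerivAt_postcomp (hY.differentiable (by simp)) (f' := Y') (fun _ => rfl)
    (constProdL 0)).comp 0 (constProdL (E := E)).hasFDerivAt
  refine ((primitiveL (E := E)).hasFDerivAt.comp 0 hpost).congr_fderiv ?_
  refine ContinuousLinearMap.ext fun p => congr_arg primitiveL (ContinuousMap.ext fun t => ?_)
  exact DFunLike.congr_fun hY'.fderiv (p.1, p.2 t)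

/-- Smooth dependence on the parameter `ξ` near `0` of the time `1` point of the integral curve
issued from `0` of the vector field `X (ξ, ·)`, when `X (0, ·)` vanishes. -/
theorem exists_isSmoothGerm_flow [FiniteDimensional ℝ E] {X : E × E → E} {s : Set (E × E)}
    (hs : s ∈ 𝓝 0) (hX : ContDiffOn ℝ ∞ X s) (hX0 : ∀ᶠ g in 𝓝 (0 : E), X (0, g) = 0)
    (hXid : ∀ ξ, X (ξ, 0) = ξ) :
    ∃ e : E → E, IsSmoothGerm e ∧ HasFDerivAt e (.id ℝ E) 0 ∧
      ∀ W ∈ 𝓝 (0 : E), ∀ᶠ ξ in 𝓝 (0 : E), ∃ γ : ℝ → E, γ 0 = 0 ∧ γ 1 = e ξ ∧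
        ∀ t ∈ Icc (0 : ℝ) 1, γ t ∈ W ∧ HasDerivWithinAt γ (X (ξ, γ t)) (Icc 0 1) t := by
  have : CompleteSpace E := FiniteDimensional.complete ℝ E
  obtain ⟨Y₀, hY, hYX⟩ := exists_contDiff_eventuallyEq hs hX
  let Y : C(E × E, E) := ⟨Y₀, hY.continuous⟩
  have hinl := (IsSmoothGerm.of_clm (.inl ℝ E E)).tendsto
  have hinr := (IsSmoothGerm.of_clm (.inr ℝ E E)).tendsto
  have hY' : HasFDerivAt Y (.fst ℝ E E) 0 :=
    hasFDerivAt_fst_of_eventually (hY.contDiffAt.differentiableAt (by simp))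
      ((hinl.eventually hYX).mono fun ξ hξ => hξ.trans (hXid ξ))
      ((hinr.eventually hYX).mp (hX0.mono fun _ h0 h => h.trans h0))
  have hY0 : Y 0 = 0 := hYX.self_of_nhds.trans (hXid 0)
  have hpicard : IsSmoothGerm (picard Y) := ⟨(contDiff_picard hY).contDiffAt,
    (congr_arg primitiveL (ContinuousMap.ext fun _ => hY0)).trans (map_zero _)⟩
  obtain ⟨c, hc, hDc, hfix⟩ :=
    exists_isSmoothGerm_fixedPoint hpicard (hasFDerivAt_picard (Y := Y) hY hY')
  let ev : C(I, E) →L[ℝ] E := ContinuousMap.evalCLM ℝ (1 : I)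
  refine ⟨fun ξ => ev (c ξ), (IsSmoothGerm.of_clm ev).comp hc, ?_, ?_⟩
  · refine (ev.hasFDerivAt.comp (0 : E) hDc).congr_fderiv (ContinuousLinearMap.ext fun ξ => ?_)
    change ∫ _ in (0 : ℝ)..1, ξ = ξ
    simp
  · intro W hW
    have hYXW : ∀ᶠ p : E × E in 𝓝 0, Y p = X p ∧ p.2 ∈ W :=
      hYX.and ((continuous_snd.tendsto (0 : E × E)).eventually hW)
    obtain ⟨r, hr, hball⟩ := Metric.eventually_nhds_iff_ball.1 hYXW
    have hsmall := ((IsSmoothGerm.of_clm (.id ℝ E)).prodMk hc).tendsto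
    filter_upwards [hfix, hsmall.eventually (Metric.ball_mem_nhds _ hr)] with ξ hξ hξr
    refine ⟨IccExtend zero_le_one (c ξ), ?_, IccExtend_right _ _, fun t ht => ?_⟩
    · rw [IccExtend_left, ← hξ]
      simp [picard, primitiveL_apply]
    · have hmem : (ξ, c ξ ⟨t, ht⟩) ∈ Metric.ball (0 : E × E) r := by
        rw [mem_ball_zero_iff]
        rw [dist_zero_right] at hξr
        exact (max_le_max le_rfl ((c ξ).norm_coe_le_norm _)).trans_lt hξr
      have hderiv := hasDerivWithinAt_primitiveL (Y.comp (constProdL (ξ, c ξ))) ht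
      rw [← picard, hξ] at hderiv
      rw [IccExtend_of_mem _ _ ht, ← (hball _ hmem).1]
      exact ⟨(hball _ hmem).2, hderiv⟩

end Flow

theorem tendsto_const_smul_zero {X : Type*} [NormedAddCommGroup X] [NormedSpace ℝ X] (c : ℝ) :
    Tendsto (fun x : X => c • x) (𝓝 0) (𝓝 0) := by
  simpa only [smul_zero] using (continuous_const_smul c).tendsto (0 : X)

namespace LocalLieGroup

variable {E : Type*} [NormedAddCommGroup E] [NormedSpace ℝ E] (G : LocalLieGroup E)

/-- The product of a local Lie group as a function of pairs. -/
def mulPair (p : E × E) : E := G.mul p.1 p.2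

theorem U_mem_nhds : G.U ∈ 𝓝 (0 : E) :=
  G.isOpen_U.mem_nhds (G.U₀_subset G.zero_mem_U₀)

theorem zero_mem_U : (0 : E) ∈ G.U := G.U₀_subset G.zero_mem_U₀

theorem contDiffAt_mulPair {g h : E} (hg : g ∈ G.U) (hh : h ∈ G.U) :
    ContDiffAt ℝ ∞ G.mulPair (g, h) :=
  G.contDiffOn_mul.contDiffAt ((G.isOpen_U.prod G.isOpen_U).mem_nhds ⟨hg, hh⟩)

theorem hasFDerivAt_mul_left {g h : E} (hg : g ∈ G.U) (hh : h ∈ G.U) :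
    HasFDerivAt (fun y => G.mul g y)
      ((fderiv ℝ G.mulPair (g, h)).comp (.inr ℝ E E)) h :=
  HasFDerivAt.comp h (g := G.mulPair) (f := fun y => (g, y))
    ((G.contDiffAt_mulPair hg hh).differentiableAt (by simp)).hasFDerivAt
    (hasFDerivAt_prodMk_right g h)

theorem leftInvariantField_eq {g : E} (hg : g ∈ G.U) (ξ : E) :
    G.leftInvariantField ξ g = fderiv ℝ G.mulPair (g, 0) (0, ξ) := by
  rw [leftInvariantField, (G.hasFDerivAt_mul_left hg G.zero_mem_U).fderiv]
  rfl

theorem leftInvariantField_smul (c : ℝ) (ξ g : E) :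
    G.leftInvariantField (c • ξ) g = c • G.leftInvariantField ξ g := by
  simp [leftInvariantField]

theorem leftInvariantField_zero (g : E) : G.leftInvariantField 0 g = 0 := by
  simp [leftInvariantField]

theorem isUnitalGerm_mulPair : IsUnitalGerm G.mulPair where
  contDiffAt := G.contDiffAt_mulPair G.zero_mem_U G.zero_mem_U
  right_unit := by filter_upwards [G.U_mem_nhds] with x hx using G.mul_zero x hx
  left_unit := by filter_upwards [G.U_mem_nhds] with x hx using G.zero_mul x hx

theorem leftInvariantField_apply_zero (ξ : E) : G.leftInvariantField ξ 0 = ξ := by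
  rw [G.leftInvariantField_eq G.zero_mem_U]
  exact (G.isUnitalGerm_mulPair.fderivs_inr ξ).1

theorem contDiffOn_leftInvariantField :
    ContDiffOn ℝ ∞ (fun p : E × E => G.leftInvariantField p.1 p.2) (univ ×ˢ G.U) := by
  have hD : ContDiffOn ℝ ∞ (fderiv ℝ G.mulPair) (G.U ×ˢ G.U) :=
    G.contDiffOn_mul.fderiv_of_isOpen (G.isOpen_U.prod G.isOpen_U) (by simp)
  have hD₀ : ContDiffOn ℝ ∞ (fun p : E × E => fderiv ℝ G.mulPair (p.2, 0)) (univ ×ˢ G.U) :=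
    hD.comp (f := fun p : E × E => ((p.2, 0) : E × E)) (by fun_prop)
      (fun p hp => ⟨hp.2, G.zero_mem_U⟩)
  have hdir : ContDiffOn ℝ ∞ (fun p : E × E => ((0, p.1) : E × E)) (univ ×ˢ G.U) := by fun_prop
  exact (hD₀.clm_apply hdir).congr fun p hp => G.leftInvariantField_eq hp.2 p.1

theorem contDiffAt_leftInvariantField (ξ : E) {g : E} (hg : g ∈ G.U) :
    ContDiffAt ℝ ∞ (G.leftInvariantField ξ) g :=
  ContDiffAt.comp g (f := fun g => (ξ, g)) (G.contDiffOn_leftInvariantField.contDiffAt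
    ((isOpen_univ.prod G.isOpen_U).mem_nhds ⟨mem_univ _, hg⟩)) (by fun_prop)

/-- `γ` is an integral curve on `[0, 1]` of the left-invariant vector field of `ξ`. -/
def IsLeftInvariantCurve (ξ : E) (γ : ℝ → E) : Prop :=
  ∀ t ∈ Icc (0 : ℝ) 1, γ t ∈ G.U ∧
    HasDerivWithinAt γ (G.leftInvariantField ξ (γ t)) (Icc 0 1) t

variable {G}

theorem IsLeftInvariantCurve.eqOn [FiniteDimensional ℝ E] {ξ : E} {γ η : ℝ → E}
    (hγ : G.IsLeftInvariantCurve ξ γ) (hη : G.IsLeftInvariantCurve ξ η) (h0 : γ 0 = η 0) :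
    EqOn γ η (Icc 0 1) := by
  have hγc : ContinuousOn γ (Icc 0 1) := fun t ht => (hγ t ht).2.continuousWithinAt
  have hηc : ContinuousOn η (Icc 0 1) := fun t ht => (hη t ht).2.continuousWithinAt
  set K := γ '' Icc 0 1 ∪ η '' Icc 0 1
  have hK : IsCompact K := (isCompact_Icc.image_of_continuousOn hγc).union
    (isCompact_Icc.image_of_continuousOn hηc)
  have hKU : K ⊆ G.U := by
    rintro _ (⟨t, ht, rfl⟩ | ⟨t, ht, rfl⟩)
    exacts [(hγ t ht).1, (hη t ht).1]
  have hLip : LocallyLipschitzOn K (G.leftInvariantField ξ) := by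
    intro g hg
    have hX : ContDiffAt ℝ 1 (G.leftInvariantField ξ) g :=
      (G.contDiffAt_leftInvariantField ξ (hKU hg)).of_le ENat.LEInfty.out
    obtain ⟨C, s, hs, hCs⟩ := hX.exists_lipschitzOnWith
    exact ⟨C, s, mem_nhdsWithin_of_mem_nhds hs, hCs⟩
  obtain ⟨C, hC⟩ := hLip.exists_lipschitzOnWith_of_compact hK
  refine ODE_solution_unique_of_mem_Icc_right (v := fun _ => G.leftInvariantField ξ)
    (s := fun _ => K) (K := C) (fun _ _ => hC) hγc (fun t ht => ?_) (fun t ht => ?_) hηc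
    (fun t ht => ?_) (fun t ht => ?_) h0
  · exact (hγ t (Ico_subset_Icc_self ht)).2.mono_of_mem_nhdsWithin (Icc_mem_nhdsGE_of_mem ht)
  · exact .inl ⟨t, Ico_subset_Icc_self ht, rfl⟩
  · exact (hη t (Ico_subset_Icc_self ht)).2.mono_of_mem_nhdsWithin (Icc_mem_nhdsGE_of_mem ht)
  · exact .inr ⟨t, Ico_subset_Icc_self ht, rfl⟩

theorem IsLeftInvariantCurve.exp_eq [FiniteDimensional ℝ E] {ξ : E} {γ : ℝ → E}
    (hγ : G.IsLeftInvariantCurve ξ γ) (h0 : γ 0 = 0) : G.exp ξ = γ 1 := by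
  have hex : ∃ g, G.IsExp ξ g := ⟨γ 1, γ, h0, rfl, hγ⟩
  rw [exp, dif_pos hex]
  obtain ⟨η, hη0, hη1, hη⟩ := hex.choose_spec
  rw [← hη1]
  exact IsLeftInvariantCurve.eqOn hη hγ (hη0.trans h0.symm) (by simp)

theorem IsLeftInvariantCurve.mul_left {ξ g : E} {γ : ℝ → E} (hγ : G.IsLeftInvariantCurve ξ γ)
    (hg : g ∈ G.U) (hmem : ∀ t ∈ Icc (0 : ℝ) 1, G.mul g (γ t) ∈ G.U) :
    G.IsLeftInvariantCurve ξ (fun t => G.mul g (γ t)) := by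
  intro t ht
  refine ⟨hmem t ht, ?_⟩
  obtain ⟨hU, hd⟩ := hγ t ht
  have hmulU : ∀ᶠ y in 𝓝 (0 : E), G.mul (γ t) y ∈ G.U := by
    have hc := (G.hasFDerivAt_mul_left hU G.zero_mem_U).continuousAt
    refine hc.tendsto.eventually_mem (G.isOpen_U.mem_nhds ?_)
    rwa [G.mul_zero _ hU]
  have heq : (fun y => G.mul (G.mul g (γ t)) y) =ᶠ[𝓝 0] fun y => G.mul g (G.mul (γ t) y) := by
    filter_upwards [hmulU, G.U_mem_nhds] with y h1 h2
    exact G.mul_assoc g hg _ hU y h2 (hmem t ht) h1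
  have hLg := G.hasFDerivAt_mul_left hg hU
  have hLγ := G.hasFDerivAt_mul_left hU G.zero_mem_U
  have hLgγ : HasFDerivAt (fun y => G.mul g (G.mul (γ t) y)) _ 0 :=
    HasFDerivAt.comp (0 : E) (g := fun y => G.mul g y) ((G.mul_zero _ hU).symm ▸ hLg) hLγ
  have hfield : G.leftInvariantField ξ (G.mul g (γ t)) =
      (fderiv ℝ G.mulPair (g, γ t)).comp (.inr ℝ E E) (G.leftInvariantField ξ (γ t)) := by
    rw [leftInvariantField, heq.fderiv_eq, hLgγ.fderiv, ContinuousLinearMap.comp_apply,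
      leftInvariantField, hLγ.fderiv, G.mul_zero _ hU]
  rw [hfield]
  exact hLg.comp_hasDerivWithinAt t hd

theorem IsLeftInvariantCurve.comp_half {ξ : E} {γ : ℝ → E}
    (hγ : G.IsLeftInvariantCurve ((2 : ℝ) • ξ) γ) {c : ℝ} (hc0 : 0 ≤ c) (hc1 : c ≤ 1 / 2) :
    G.IsLeftInvariantCurve ξ (fun t => γ (c + t / 2)) := by
  intro t ht
  have hmaps : MapsTo (fun t : ℝ => c + t / 2) (Icc 0 1) (Icc 0 1) := fun s hs =>
    ⟨by have := hs.1; positivity, by have := hs.2; linarith⟩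
  obtain ⟨hU, hd⟩ := hγ _ (hmaps ht)
  refine ⟨hU, ?_⟩
  have hparam : HasDerivWithinAt (fun t : ℝ => c + t / 2) (1 / 2) (Icc 0 1) t :=
    (((hasDerivAt_id t).div_const 2).const_add c).hasDerivWithinAt
  have hcomp := HasDerivWithinAt.scomp t hd hparam hmaps
  rw [G.leftInvariantField_smul, smul_smul] at hcomp
  simpa [Function.comp_def] using hcomp

variable (G)

theorem exp_isSmoothGerm_and_curve [FiniteDimensional ℝ E] :
    IsSmoothGerm G.exp ∧ HasFDerivAt G.exp (.id ℝ E) 0 ∧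
      ∀ W ∈ 𝓝 (0 : E), ∀ᶠ ξ in 𝓝 (0 : E), ∃ γ : ℝ → E, γ 0 = 0 ∧ γ 1 = G.exp ξ ∧
        (∀ t ∈ Icc (0 : ℝ) 1, γ t ∈ W) ∧ G.IsLeftInvariantCurve ξ γ := by
  obtain ⟨e, he, hde, hcurve⟩ := exists_isSmoothGerm_flow
    (X := fun p : E × E => G.leftInvariantField p.1 p.2)
    ((isOpen_univ.prod G.isOpen_U).mem_nhds ⟨mem_univ _, G.zero_mem_U⟩)
    G.contDiffOn_leftInvariantField (.of_forall fun g => G.leftInvariantField_zero g)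
    G.leftInvariantField_apply_zero
  have heq : G.exp =ᶠ[𝓝 0] e := by
    filter_upwards [hcurve _ G.U_mem_nhds] with ξ ⟨γ, h0, h1, hγ⟩
    exact (IsLeftInvariantCurve.exp_eq (G := G) hγ h0).trans h1
  refine ⟨he.congr' heq, hde.congr_of_eventuallyEq heq, fun W hW => ?_⟩
  filter_upwards [hcurve _ (inter_mem hW G.U_mem_nhds), heq] with ξ ⟨γ, h0, h1, hγ⟩ hξ
  exact ⟨γ, h0, h1.trans hξ.symm, fun t ht => (hγ t ht).1.1,
    fun t ht => ⟨(hγ t ht).1.2, (hγ t ht).2⟩⟩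

theorem isSmoothGerm_mulPair : IsSmoothGerm G.mulPair :=
  G.isUnitalGerm_mulPair.isSmoothGerm

theorem fderiv_leftInvariantField_zero (ξ η : E) :
    fderiv ℝ (G.leftInvariantField η) 0 ξ = mixedXY G.mulPair ξ η := by
  have hfield : G.leftInvariantField η =ᶠ[𝓝 0] fun g => fderiv ℝ G.mulPair (g, 0) (0, η) := by
    filter_upwards [G.U_mem_nhds] with g hg using G.leftInvariantField_eq hg η
  have hsmooth : ContDiffAt ℝ 1 (fderiv ℝ G.mulPair) 0 :=
    G.isUnitalGerm_mulPair.contDiffAt_two.fderiv_right (by norm_num)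
  have hD : HasFDerivAt (fun g : E => fderiv ℝ G.mulPair (g, 0)) _ 0 :=
    HasFDerivAt.comp (0 : E) (f := fun g : E => ((g, 0) : E × E))
      (hsmooth.differentiableAt one_ne_zero).hasFDerivAt
      (ContinuousLinearMap.inl ℝ E E).hasFDerivAt
  rw [hfield.fderiv_eq, (hD.clm_apply (hasFDerivAt_const ((0, η) : E × E) 0)).fderiv]
  simp [mixedXY_apply]

theorem bracket_eq_mulPair (ξ η : E) :
    G.bracket ξ η = mixedXY G.mulPair ξ η - mixedXY G.mulPair η ξ := by
  rw [bracket, VectorField.lieBracket, G.leftInvariantField_apply_zero,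
    G.leftInvariantField_apply_zero, G.fderiv_leftInvariantField_zero,
    G.fderiv_leftInvariantField_zero]

variable [FiniteDimensional ℝ E]

theorem isSmoothGerm_exp : IsSmoothGerm G.exp := G.exp_isSmoothGerm_and_curve.1

theorem hasFDerivAt_exp : HasFDerivAt G.exp (.id ℝ E) 0 := G.exp_isSmoothGerm_and_curve.2.1

theorem exp_mul_exp_self :
    ∀ᶠ ξ in 𝓝 (0 : E), G.mul (G.exp ξ) (G.exp ξ) = G.exp ((2 : ℝ) • ξ) := by
  obtain ⟨W, hW, hWU⟩ : ∃ W ∈ 𝓝 (0 : E), ∀ g ∈ W, ∀ h ∈ W, G.mul g h ∈ G.U := by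
    have h := G.isSmoothGerm_mulPair.tendsto.eventually_mem G.U_mem_nhds
    rw [← Prod.mk_zero_zero, nhds_prod_eq] at h
    obtain ⟨W, hW, h⟩ := (eventually_prod_self_iff (r := fun g h => G.mul g h ∈ G.U)).1 h
    exact ⟨W, hW, fun g hg k hk => h g hg k hk⟩
  have hcurve := G.exp_isSmoothGerm_and_curve.2.2 W hW
  filter_upwards [hcurve, (tendsto_const_smul_zero 2).eventually hcurve,
    G.isSmoothGerm_exp.tendsto.eventually_mem (inter_mem hW G.U_mem_nhds)]
    with ξ ⟨γ, hγ0, hγ1, hγW, hγ⟩ ⟨η, hη0, hη1, _, hη⟩ hξ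
  have hhalf : G.exp ξ = η (1 / 2) := by
    simpa using IsLeftInvariantCurve.exp_eq (hη.comp_half le_rfl (by norm_num)) (by simpa using hη0)
  have htranslate := hγ.mul_left hξ.2 (fun t ht => hWU _ hξ.1 _ (hγW t ht))
  have hsecond := hη.comp_half (c := 1 / 2) (by norm_num) le_rfl
  have hstart : G.mul (G.exp ξ) (γ 0) = η (1 / 2 + 0 / 2) := by
    rw [hγ0, G.mul_zero _ hξ.2, hhalf, zero_div, add_zero]
  have hend := htranslate.eqOn hsecond hstart (right_mem_Icc.2 zero_le_one)
  simpa only [add_halves, hη1, hγ1] using hend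

theorem exists_log : ∃ log : E → E, IsSmoothGerm log ∧
    (∀ᶠ x in 𝓝 0, log (G.exp x) = x) ∧ ∀ᶠ g in 𝓝 0, G.exp (log g) = g := by
  have : CompleteSpace E := FiniteDimensional.complete ℝ E
  obtain ⟨log, hlog, -, hinv⟩ :=
    exists_local_inverse G.isSmoothGerm_exp (e := .refl ℝ E) G.hasFDerivAt_exp
  exact ⟨log, hlog, hinv⟩

/-- A chosen logarithm, the inverse of the exponential map near `0`. -/
def log : E → E := G.exists_log.choose

/-- The group law in logarithmic coordinates. -/
def bch (p : E × E) : E := G.log (G.mul (G.exp p.1) (G.exp p.2))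

theorem isSmoothGerm_log : IsSmoothGerm G.log := G.exists_log.choose_spec.1

theorem log_exp : ∀ᶠ x in 𝓝 0, G.log (G.exp x) = x := G.exists_log.choose_spec.2.1

theorem exp_log : ∀ᶠ g in 𝓝 0, G.exp (G.log g) = g := G.exists_log.choose_spec.2.2

theorem isSmoothGerm_exp_mul_exp :
    IsSmoothGerm fun p : E × E => G.mul (G.exp p.1) (G.exp p.2) :=
  G.isSmoothGerm_mulPair.comp ((G.isSmoothGerm_exp.comp (.of_clm (.fst ℝ E E))).prodMk
    (G.isSmoothGerm_exp.comp (.of_clm (.snd ℝ E E))))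

theorem exp_bch : ∀ᶠ p : E × E in 𝓝 0, G.exp (G.bch p) = G.mul (G.exp p.1) (G.exp p.2) :=
  G.isSmoothGerm_exp_mul_exp.tendsto.eventually G.exp_log

theorem bch_assoc : ∀ᶠ p : E × E × E in 𝓝 0,
    G.bch (G.bch (p.1, p.2.1), p.2.2) = G.bch (p.1, G.bch (p.2.1, p.2.2)) := by
  have hx : Tendsto (fun p : E × E × E => p.1) (𝓝 0) (𝓝 0) := continuous_fst.tendsto 0
  have hyz : Tendsto (fun p : E × E × E => p.2) (𝓝 0) (𝓝 0) := continuous_snd.tendsto 0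
  have hy : Tendsto (fun p : E × E × E => p.2.1) (𝓝 0) (𝓝 0) := hyz.fst_nhds
  have hz : Tendsto (fun p : E × E × E => p.2.2) (𝓝 0) (𝓝 0) := hyz.snd_nhds
  have hxy : Tendsto (fun p : E × E × E => (p.1, p.2.1)) (𝓝 0) (𝓝 0) := hx.prodMk_nhds hy
  have hexp := G.isSmoothGerm_exp.tendsto.eventually_mem G.U_mem_nhds
  have hmul := G.isSmoothGerm_exp_mul_exp.tendsto.eventually_mem G.U_mem_nhds
  filter_upwards [hxy.eventually G.exp_bch, hyz.eventually G.exp_bch, hx.eventually hexp,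
    hy.eventually hexp, hz.eventually hexp, hxy.eventually hmul, hyz.eventually hmul]
    with p hbch_xy hbch_yz hxU hyU hzU hxyU hyzU
  have hassoc := G.mul_assoc _ hxU _ hyU _ hzU hxyU hyzU
  simp only [bch] at hbch_xy hbch_yz ⊢
  rw [hbch_xy, hbch_yz, hassoc]

theorem isNormalGroupGerm_bch : IsNormalGroupGerm G.bch where
  contDiffAt := (G.isSmoothGerm_log.comp G.isSmoothGerm_exp_mul_exp).contDiffAt
  right_unit := by
    filter_upwards [G.log_exp, G.isSmoothGerm_exp.tendsto.eventually_mem G.U_mem_nhds] with x hx hU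
    rw [bch, G.isSmoothGerm_exp.map_zero, G.mul_zero _ hU, hx]
  left_unit := by
    filter_upwards [G.log_exp, G.isSmoothGerm_exp.tendsto.eventually_mem G.U_mem_nhds] with x hx hU
    rw [bch, G.isSmoothGerm_exp.map_zero, G.zero_mul _ hU, hx]
  assoc := G.bch_assoc
  double := by
    filter_upwards [G.exp_mul_exp_self, (tendsto_const_smul_zero 2).eventually G.log_exp]
      with x hmul hlog
    exact (congr_arg G.log hmul).trans hlog

theorem mixedXY_mulPair (ξ η : E) : mixedXY G.mulPair ξ η =
    mixedXY G.bch ξ η + fderiv ℝ (fderiv ℝ G.exp) 0 ξ η := by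
  have hexp : ContDiffAt ℝ 3 G.exp 0 := G.isSmoothGerm_exp.contDiffAt.of_le ENat.LEInfty.out
  have hexp0 := G.isSmoothGerm_exp.map_zero
  have hξ := HasCubicJet.line ξ
  have hη := HasCubicJet.line η
  have hbch := (G.isNormalGroupGerm_bch.hasCubicJet hξ hη).comp_contDiffAt hexp hexp0
  have hmul := G.isUnitalGerm_mulPair.hasCubicJet (hξ.comp_contDiffAt hexp hexp0)
    (hη.comp_contDiffAt hexp hexp0)
  have hquad := ((hbch.congr' (eventually_smul G.exp_bch (ξ, η))).coeff_unique hmul).2.1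
  simp only [G.hasFDerivAt_exp.fderiv, ContinuousLinearMap.id_apply, map_add, add_apply,
    fderiv_fderiv_symm (hexp.of_le (by norm_num)) η ξ] at hquad
  linear_combination (norm := module) -hquad

theorem bracket_eq_bch (ξ η : E) : G.bracket ξ η = (2 : ℝ) • mixedXY G.bch ξ η := by
  have hexp : ContDiffAt ℝ 2 G.exp 0 := G.isSmoothGerm_exp.contDiffAt.of_le ENat.LEInfty.out
  rw [G.bracket_eq_mulPair, G.mixedXY_mulPair, G.mixedXY_mulPair, fderiv_fderiv_symm hexp η ξ,
    G.isNormalGroupGerm_bch.mixedXY_antisymm η ξ]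
  module

end LocalLieGroup

section Graphs

variable {E : Type*} [NormedAddCommGroup E] [NormedSpace ℝ E] {V W : Submodule ℝ E}

theorem projectionOntoL_add (h : V.IsTopCompl W) (x : V) (w : W) :
    V.projectionOntoL W h ((x : E) + w) = x := by
  rw [map_add, Submodule.projectionOntoL_apply_left, Submodule.projectionOntoL_apply_right,
    add_zero]

theorem projectionOntoL_symm_add (h : V.IsTopCompl W) (x : V) (w : W) :
    W.projectionOntoL V h.symm ((x : E) + w) = w := by
  rw [add_comm, projectionOntoL_add]

theorem projectionOntoL_add_projectionOntoL_symm (h : V.IsTopCompl W) (e : E) :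
    (V.projectionOntoL W h e : E) + W.projectionOntoL V h.symm e = e :=
  Submodule.projectionL_add_projectionL_eq_self h e

theorem eq_of_projectionOntoL_eq (h : V.IsTopCompl W) {e f : E}
    (hV : V.projectionOntoL W h e = V.projectionOntoL W h f)
    (hW : W.projectionOntoL V h.symm e = W.projectionOntoL V h.symm f) : e = f := by
  rw [← projectionOntoL_add_projectionOntoL_symm h e, hV, hW,
    projectionOntoL_add_projectionOntoL_symm]

theorem eventually_projectionOntoL_symm_eq_iff (h : V.IsTopCompl W) {A B : E → E}
    (hA : ∀ η, V.projectionOntoL W h (A η) = V.projectionOntoL W h η)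
    (hBA : ∀ᶠ η in 𝓝 0, B (A η) = η) (hAB : ∀ᶠ y in 𝓝 0, A (B y) = y) :
    ∀ᶠ η in 𝓝 (0 : E), W.projectionOntoL V h.symm (A η) = 0 ↔
      W.projectionOntoL V h.symm η = W.projectionOntoL V h.symm (B (V.projectionOntoL W h η)) := by
  have hπ : Tendsto (fun η : E => (V.projectionOntoL W h η : E)) (𝓝 0) (𝓝 0) :=
    (IsSmoothGerm.of_clm (V.subtypeL.comp (V.projectionOntoL W h))).tendsto
  filter_upwards [hBA, hπ.eventually hAB] with η hη hπη
  constructor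
  · intro h0
    have hAη : A η = V.projectionOntoL W h η := by
      rw [← projectionOntoL_add_projectionOntoL_symm h (A η), hA, h0, ZeroMemClass.coe_zero,
        add_zero]
    rw [← hAη, hη]
  · intro hW
    have hBη : B (V.projectionOntoL W h η) = η := by
      refine eq_of_projectionOntoL_eq h ?_ hW.symm
      rw [← hA, hπη, Submodule.projectionOntoL_apply_left]
    rw [← hBη, hπη, Submodule.projectionOntoL_apply_right]

/-- A germ at `0` of a smooth map which vanishes at `0` together with its derivative. -/
structure IsSecondOrderGerm {X Y : Type*} [NormedAddCommGroup X] [NormedSpace ℝ X]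
    [NormedAddCommGroup Y] [NormedSpace ℝ Y] (φ : X → Y) : Prop extends IsSmoothGerm φ where
  fderiv_eq_zero : fderiv ℝ φ 0 = 0

theorem IsSecondOrderGerm.congr' {X Y : Type*} [NormedAddCommGroup X] [NormedSpace ℝ X]
    [NormedAddCommGroup Y] [NormedSpace ℝ Y] {φ ψ : X → Y} (hφ : IsSecondOrderGerm φ)
    (h : ψ =ᶠ[𝓝 0] φ) : IsSecondOrderGerm ψ :=
  ⟨hφ.toIsSmoothGerm.congr' h, h.fderiv_eq.trans hφ.fderiv_eq_zero⟩

theorem exists_graph_of_hasFDerivAt_id [CompleteSpace E] (h : V.IsTopCompl W) {Θ : E → E}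
    (hΘ : IsSmoothGerm Θ) (hD : HasFDerivAt Θ (.id ℝ E) 0) :
    ∃ φ : V → W, IsSecondOrderGerm φ ∧ ∀ᶠ η in 𝓝 (0 : E), Θ η ∈ V ↔
      W.projectionOntoL V h.symm η = φ (V.projectionOntoL W h η) := by
  set πV := V.projectionOntoL W h
  set πW := W.projectionOntoL V h.symm
  let A : E → E := fun η => V.subtypeL (πV η) + W.subtypeL (πW (Θ η))
  have hA : IsSmoothGerm A := (IsSmoothGerm.of_clm (V.subtypeL.comp πV)).add
    ((IsSmoothGerm.of_clm (W.subtypeL.comp πW)).comp hΘ)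
  have hAD : HasFDerivAt A ((ContinuousLinearEquiv.refl ℝ E : E ≃L[ℝ] E) : E →L[ℝ] E) 0 :=
    ((V.subtypeL.comp πV).hasFDerivAt.add
      ((W.subtypeL.comp πW).hasFDerivAt.comp 0 hD)).congr_fderiv
      (ContinuousLinearMap.ext (projectionOntoL_add_projectionOntoL_symm h))
  obtain ⟨B, hB, hBD, hBA, hAB⟩ := exists_local_inverse hA hAD
  have hφ : IsSmoothGerm fun x : V => πW (B x) :=
    (IsSmoothGerm.of_clm πW).comp (hB.comp (.of_clm V.subtypeL))
  have hφD : HasFDerivAt (fun x : V => πW (B x)) _ 0 :=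
    πW.hasFDerivAt.comp (0 : V)
      (HasFDerivAt.comp (0 : V) (f := V.subtypeL) hBD V.subtypeL.hasFDerivAt)
  refine ⟨_, ⟨hφ, hφD.fderiv.trans ?_⟩, ?_⟩
  · exact ContinuousLinearMap.ext (Submodule.projectionOntoL_apply_right h.symm)
  · filter_upwards [eventually_projectionOntoL_symm_eq_iff h
      (fun η => projectionOntoL_add h _ _) hBA hAB] with η hη
    rw [← hη, projectionOntoL_symm_add h, Submodule.projectionOntoL_apply_eq_zero_iff]

theorem eventually_eq_zero_of_map_two_smul {X Y : Type*} [NormedAddCommGroup X] [NormedSpace ℝ X]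
    [NormedAddCommGroup Y] [NormedSpace ℝ Y] {ψ : X → Y} (hψ : IsSecondOrderGerm ψ)
    (hdouble : ∀ᶠ x in 𝓝 (0 : X), ψ ((2 : ℝ) • x) = (2 : ℝ) • ψ x) : ∀ᶠ x in 𝓝 0, ψ x = 0 := by
  obtain ⟨r, hr, hball⟩ := Metric.eventually_nhds_iff_ball.1 hdouble
  filter_upwards [Metric.ball_mem_nhds (0 : X) hr] with x hx
  have hmem (n : ℕ) : ((2 : ℝ) ^ n)⁻¹ • x ∈ Metric.ball (0 : X) r := by
    refine balanced_ball_zero.smul_mem ?_ hx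
    rw [norm_inv, norm_pow, Real.norm_two]
    exact inv_le_one_of_one_le₀ (one_le_pow₀ one_le_two)
  have hiter (n : ℕ) : (2 : ℝ) ^ n • ψ (((2 : ℝ) ^ n)⁻¹ • x) = ψ x := by
    induction n with
    | zero => simp
    | succ n ih =>
      rw [← ih, pow_succ, mul_smul, ← hball _ (pow_succ (2 : ℝ) n ▸ hmem (n + 1)), mul_inv_rev,
        mul_smul, smul_inv_smul₀ two_ne_zero]
  have hlim := hψ.hasFDerivAt.lim x (c := fun n : ℕ => (2 : ℝ) ^ n) (l := atTop)
    (by simpa using tendsto_pow_atTop_atTop_of_one_lt (one_lt_two (α := ℝ)))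
  simp only [zero_add, hψ.map_zero, sub_zero, hiter, hψ.fderiv_eq_zero, zero_apply] at hlim
  exact tendsto_nhds_unique tendsto_const_nhds hlim

/-- The map `x ↦ x + φ x` parametrizing the graph of `φ`. -/
def graphMap (φ : V → W) (x : V) : E := (x : E) + φ x

theorem isSmoothGerm_graphMap {φ : V → W} (hφ : IsSmoothGerm φ) : IsSmoothGerm (graphMap φ) :=
  (IsSmoothGerm.of_clm V.subtypeL).add ((IsSmoothGerm.of_clm W.subtypeL).comp hφ)

theorem hasFDerivAt_graphMap {φ : V → W} (hφ : IsSecondOrderGerm φ) :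
    HasFDerivAt (graphMap φ) V.subtypeL 0 := by
  have hφD := hφ.hasFDerivAt
  rw [hφ.fderiv_eq_zero] at hφD
  have hsum : HasFDerivAt (graphMap φ) _ 0 :=
    V.subtypeL.hasFDerivAt.add (W.subtypeL.hasFDerivAt.comp 0 hφD)
  rwa [ContinuousLinearMap.comp_zero, add_zero] at hsum

end Graphs

section SubmanifoldsOfLieGroups

variable {E : Type*} [NormedAddCommGroup E] [NormedSpace ℝ E]
  {V 𝔥 : Submodule ℝ E}

namespace LocalLieGroup

variable {G : LocalLieGroup E} {Q : Set E}

theorem IsSectionMap.eventuallyEq_of_graph {φ ψ : V → 𝔥} (hc : V.IsTopCompl 𝔥)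
    (hφ : G.IsSectionMap Q φ) (hgraph : ∀ᶠ η in 𝓝 (0 : E), G.exp η ∈ Q ↔
      𝔥.projectionOntoL V hc.symm η = ψ (V.projectionOntoL 𝔥 hc η)) : φ =ᶠ[𝓝 0] ψ := by
  have hs : Tendsto (graphMap φ) (𝓝 0) (𝓝 0) := by
    have hcont : ContinuousAt (graphMap φ) 0 :=
      continuous_subtype_val.continuousAt.add
        (continuous_subtype_val.continuousAt.comp hφ.continuousAt)
    simpa only [graphMap, ContinuousAt, hφ.map_zero, ZeroMemClass.coe_zero, add_zero] using hcont
  filter_upwards [hφ.mem, hs.eventually hgraph] with x hx hxgraph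
  simpa only [graphMap, projectionOntoL_add, projectionOntoL_symm_add hc] using hxgraph.1 hx

variable [FiniteDimensional ℝ E]

variable (G) in
theorem exists_graph_of_isSubmanifoldAtZero {S : Set E}
    (hS : IsSubmanifoldAtZero S V) (hc : V.IsTopCompl 𝔥) :
    ∃ φ : V → 𝔥, IsSecondOrderGerm φ ∧ ∀ᶠ η in 𝓝 (0 : E), G.exp η ∈ S ↔
      𝔥.projectionOntoL V hc.symm η = φ (V.projectionOntoL 𝔥 hc η) := by
  have : CompleteSpace E := FiniteDimensional.complete ℝ E
  obtain ⟨Φ, h0, hΦ0, hΦ, -, hD, hmem⟩ := hS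
  have hsource : Φ.source ∈ 𝓝 (0 : E) := Φ.open_source.mem_nhds h0
  have hΦG : IsSmoothGerm Φ := ⟨hΦ.contDiffAt hsource, hΦ0⟩
  have hexp0 := G.isSmoothGerm_exp.map_zero
  have hcomp : HasFDerivAt (fun η => Φ (G.exp η)) (.id ℝ E) 0 :=
    HasFDerivAt.comp (0 : E) (g := Φ) (g' := .id ℝ E) (hexp0.symm ▸ hD) G.hasFDerivAt_exp
  obtain ⟨φ, hφ, hgraph⟩ :=
    exists_graph_of_hasFDerivAt_id hc (hΦG.comp G.isSmoothGerm_exp) hcomp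
  refine ⟨φ, hφ, ?_⟩
  filter_upwards [hgraph, G.isSmoothGerm_exp.tendsto.eventually_mem hsource] with η hη hηS
  rw [hmem _ hηS, hη]

theorem IsLocalLieSubgroup.exp_mem_iff {H : Set E}
    (hH : G.IsLocalLieSubgroup H 𝔥) (hc : V.IsTopCompl 𝔥) :
    ∀ᶠ η in 𝓝 (0 : E), G.exp η ∈ H ↔ η ∈ 𝔥 := by
  obtain ⟨ψ, hψ, hgraph⟩ := G.exists_graph_of_isSubmanifoldAtZero hH.isSubmanifold hc.symm
  obtain ⟨N, hN, hmul⟩ := hH.mul_mem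
  have hdouble : ∀ᶠ k in 𝓝 (0 : 𝔥), ψ ((2 : ℝ) • k) = (2 : ℝ) • ψ k := by
    have hs := (isSmoothGerm_graphMap hψ.toIsSmoothGerm).tendsto
    filter_upwards [hs.eventually hgraph,
      hs.eventually ((tendsto_const_smul_zero 2).eventually hgraph),
      hs.eventually G.exp_mul_exp_self,
      hs.eventually (G.isSmoothGerm_exp.tendsto.eventually_mem hN)]
      with k hk h2k hsq hkN
    simp only [graphMap, map_smul, projectionOntoL_add, projectionOntoL_symm_add hc.symm]
      at hk h2k hsq hkN
    have hkH := hk.2 trivial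
    exact (h2k.1 (hsq ▸ hmul _ ⟨hkH, hkN⟩ _ ⟨hkH, hkN⟩)).symm
  have hπ : Tendsto (𝔥.projectionOntoL V hc.symm) (𝓝 0) (𝓝 0) := (IsSmoothGerm.of_clm _).tendsto
  filter_upwards [hgraph, hπ.eventually (eventually_eq_zero_of_map_two_smul hψ hdouble)]
    with η hη hψη
  rw [hη, hψη, Submodule.projectionOntoL_apply_eq_zero_iff]

variable (G) in
theorem exists_isSectionMap (hQ : IsSubmanifoldAtZero Q V) (hc : V.IsTopCompl 𝔥) :
    ∃ φ : V → 𝔥, G.IsSectionMap Q φ := by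
  obtain ⟨φ, hφ, hgraph⟩ := G.exists_graph_of_isSubmanifoldAtZero hQ hc
  refine ⟨φ, hφ.map_zero, hφ.contDiffAt.continuousAt, ?_⟩
  filter_upwards [(isSmoothGerm_graphMap hφ.toIsSmoothGerm).tendsto.eventually hgraph] with x hx
  refine hx.2 ?_
  rw [graphMap, projectionOntoL_add, projectionOntoL_symm_add hc]

theorem IsSectionMap.isSecondOrderGerm {φ : V → 𝔥} (hφ : G.IsSectionMap Q φ)
    (hQ : IsSubmanifoldAtZero Q V) (hc : V.IsTopCompl 𝔥) : IsSecondOrderGerm φ := by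
  obtain ⟨ψ, hψ, hgraph⟩ := G.exists_graph_of_isSubmanifoldAtZero hQ hc
  exact hψ.congr' (hφ.eventuallyEq_of_graph hc hgraph)

end LocalLieGroup

end SubmanifoldsOfLieGroups

section LoopGerms

variable {E : Type*} [NormedAddCommGroup E] [NormedSpace ℝ E] {V W : Submodule ℝ E}
  {m : E × E → E} {φ : V → W}

theorem IsUnitalGerm.exists_factorization [CompleteSpace E] (hm : IsUnitalGerm m)
    (hφ : IsSecondOrderGerm φ) (hc : V.IsTopCompl W) :
    ∃ B : E → V × W, IsSmoothGerm B ∧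
      (∀ᶠ p : V × W in 𝓝 0, B (m (graphMap φ p.1, (p.2 : E))) = p) ∧
      ∀ᶠ g in 𝓝 (0 : E), m (graphMap φ (B g).1, ((B g).2 : E)) = g := by
  let e := V.prodEquivOfIsTopCompl W hc
  have : CompleteSpace (V × W) :=
    (completeSpace_congr (e := e.toEquiv) e.isUniformEmbedding).2 inferInstance
  have hs := isSmoothGerm_graphMap hφ.toIsSmoothGerm
  have hA : IsSmoothGerm fun p : V × W => m (graphMap φ p.1, (p.2 : E)) :=
    hm.isSmoothGerm.comp ((hs.comp (.of_clm (.fst ℝ V W))).prodMk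
      (.of_clm (W.subtypeL.comp (.snd ℝ V W))))
  have hpair : HasFDerivAt (fun p : V × W => (graphMap φ p.1, (p.2 : E))) _ 0 :=
    (HasFDerivAt.comp (0 : V × W) (f := Prod.fst) (hasFDerivAt_graphMap hφ) hasFDerivAt_fst).prodMk
      (W.subtypeL.comp (.snd ℝ V W)).hasFDerivAt
  have hm0 : HasFDerivAt m (fderiv ℝ m 0)
      (graphMap φ (0 : V × W).1, (((0 : V × W).2 : W) : E)) := by
    have h00 : (graphMap φ (0 : V × W).1, (((0 : V × W).2 : W) : E)) = 0 :=
      Prod.ext hs.map_zero rfl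
    exact h00.symm ▸ hm.isSmoothGerm.hasFDerivAt
  have hAD : HasFDerivAt (fun p : V × W => m (graphMap φ p.1, (p.2 : E))) _ 0 :=
    HasFDerivAt.comp (0 : V × W) (g := m) hm0 hpair
  have hAe : HasFDerivAt (fun p : V × W => m (graphMap φ p.1, (p.2 : E))) (e : V × W →L[ℝ] E) 0 :=
    hAD.congr_fderiv (ContinuousLinearMap.ext fun p => hm.fderiv_apply _ _)
  obtain ⟨B, hB, -, hleft, hright⟩ := exists_local_inverse hA hAe
  exact ⟨B, hB, hleft, hright⟩

/-- The germ `μ` is the loop law on the graph of `φ` induced by the operation `m`: the product of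
two points of the graph is the point over `μ` times the element `k` of `W`. -/
structure IsLoopGerm (m : E × E → E) (φ : V → W) (μ : V × V → V) (k : V × V → W) : Prop
    extends IsUnitalGerm μ where
  isSmoothGerm_right : IsSmoothGerm k
  factor : ∀ᶠ p : V × V in 𝓝 0,
    m (graphMap φ p.1, graphMap φ p.2) = m (graphMap φ (μ p), (k p : E))

theorem IsLoopGerm.congr' {μ ν : V × V → V} {k : V × V → W} (h : IsLoopGerm m φ μ k)
    (hν : ν =ᶠ[𝓝 0] μ) : IsLoopGerm m φ ν k where
  contDiffAt := h.contDiffAt.congr_of_eventuallyEq hν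
  right_unit := by
    have hinl : Tendsto (fun x : V => (x, (0 : V))) (𝓝 0) (𝓝 0) :=
      (IsSmoothGerm.of_clm (.inl ℝ V V)).tendsto
    filter_upwards [hinl.eventually hν, h.right_unit] with x hx hμ using hx.trans hμ
  left_unit := by
    have hinr : Tendsto (fun y : V => ((0 : V), y)) (𝓝 0) (𝓝 0) :=
      (IsSmoothGerm.of_clm (.inr ℝ V V)).tendsto
    filter_upwards [hinr.eventually hν, h.left_unit] with y hy hμ using hy.trans hμ
  isSmoothGerm_right := h.isSmoothGerm_right
  factor := by
    filter_upwards [hν, h.factor] with p hp hμ using hp.symm ▸ hμ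

theorem IsUnitalGerm.exists_isLoopGerm [CompleteSpace E] (hm : IsUnitalGerm m)
    (hφ : IsSecondOrderGerm φ) (hc : V.IsTopCompl W) :
    ∃ (μ : V × V → V) (k : V × V → W), IsLoopGerm m φ μ k ∧
      ∀ (ν : V × V → V) (l : V × V → W), Tendsto ν (𝓝 0) (𝓝 0) → Tendsto l (𝓝 0) (𝓝 0) →
        (∀ᶠ p : V × V in 𝓝 0,
          m (graphMap φ p.1, graphMap φ p.2) = m (graphMap φ (ν p), (l p : E))) →
        ν =ᶠ[𝓝 0] μ := by
  obtain ⟨B, hB, hleft, hright⟩ := hm.exists_factorization hφ hc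
  have hs := isSmoothGerm_graphMap hφ.toIsSmoothGerm
  have hprod : IsSmoothGerm fun p : V × V => m (graphMap φ p.1, graphMap φ p.2) :=
    hm.isSmoothGerm.comp ((hs.comp (.of_clm (.fst ℝ V V))).prodMk (hs.comp (.of_clm (.snd ℝ V V))))
  have hBgraph : ∀ᶠ x in 𝓝 (0 : V), B (graphMap φ x) = (x, 0) := by
    have hinl : Tendsto (fun x : V => (x, (0 : W))) (𝓝 0) (𝓝 0) :=
      (IsSmoothGerm.of_clm (.inl ℝ V W)).tendsto
    filter_upwards [hinl.eventually hleft, hs.tendsto.eventually hm.right_unit] with x hx hunit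
    rwa [ZeroMemClass.coe_zero, hunit] at hx
  refine ⟨_, _, ⟨⟨((IsSmoothGerm.of_clm (.fst ℝ V W)).comp (hB.comp hprod)).contDiffAt, ?_, ?_⟩,
    (IsSmoothGerm.of_clm (.snd ℝ V W)).comp (hB.comp hprod), ?_⟩, fun ν l hν hl hνl => ?_⟩
  · filter_upwards [hBgraph, hs.tendsto.eventually hm.right_unit] with x hx hunit
    simp only [hs.map_zero, hunit, hx, ContinuousLinearMap.coe_fst']
  · filter_upwards [hBgraph, hs.tendsto.eventually hm.left_unit] with x hx hunit
    simp only [hs.map_zero, hunit, hx, ContinuousLinearMap.coe_fst']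
  · filter_upwards [hprod.tendsto.eventually hright] with p hp using hp.symm
  · filter_upwards [hνl, (hν.prodMk_nhds hl).eventually hleft] with p hp hB
    simp only [hp, hB, ContinuousLinearMap.coe_fst']

end LoopGerms

section LoopLaws

namespace LocalLieGroup

variable {E : Type*} [NormedAddCommGroup E] [NormedSpace ℝ E]

theorem inv_zero (G : LocalLieGroup E) : G.inv 0 = 0 := by
  rw [← G.mul_zero _ (G.inv_mem 0 G.zero_mem_U₀)]
  exact G.inv_mul 0 G.zero_mem_U₀

theorem tendsto_inv (G : LocalLieGroup E) : Tendsto G.inv (𝓝 0) (𝓝 0) := by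
  simpa only [ContinuousAt, G.inv_zero] using
    (G.contDiffOn_inv.contDiffAt (G.isOpen_U₀.mem_nhds G.zero_mem_U₀)).continuousAt

theorem eq_inv_mul (G : LocalLieGroup E) {q h : E} (hq : q ∈ G.U₀) (hh : h ∈ G.U)
    (hqh : G.mul q h ∈ G.U) : h = G.mul (G.inv q) (G.mul q h) := by
  have hassoc := G.mul_assoc (G.inv q) (G.inv_mem q hq) q (G.U₀_subset hq) h hh
    (by rw [G.inv_mul q hq]; exact G.zero_mem_U) hqh
  rwa [G.inv_mul q hq, G.zero_mul h hh] at hassoc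

theorem tendsto_inv_mul (G : LocalLieGroup E) {X : Type*} {l : Filter X} {q g : X → E}
    (hq : Tendsto q l (𝓝 0)) (hg : Tendsto g l (𝓝 0)) :
    Tendsto (fun p => G.mul (G.inv (q p)) (g p)) l (𝓝 0) :=
  G.isSmoothGerm_mulPair.tendsto.comp ((G.tendsto_inv.comp hq).prodMk_nhds hg)

variable {G : LocalLieGroup E} {H Q : Set E} {V 𝔥 : Submodule ℝ E} {φ : V → 𝔥} {μ : V × V → V}

theorem IsLoopLaw.tendsto (hμ : G.IsLoopLaw H Q φ μ) : Tendsto μ (𝓝 0) (𝓝 0) := by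
  simpa only [ContinuousAt, hμ.map_zero] using hμ.continuousAt

variable [FiniteDimensional ℝ E]

theorem _root_.IsLoopGerm.isLoopLaw {k : V × V → 𝔥} (h : IsLoopGerm G.bch φ μ k)
    (hφQ : G.IsSectionMap Q φ) (hφ : IsSmoothGerm φ)
    (hexpH : ∀ᶠ η in 𝓝 (0 : E), G.exp η ∈ H ↔ η ∈ 𝔥) : G.IsLoopLaw H Q φ μ := by
  have hs := (isSmoothGerm_graphMap hφ).tendsto
  have hμ := h.toIsUnitalGerm.isSmoothGerm
  have hk : Tendsto (fun p => (k p : E)) (𝓝 0) (𝓝 0) :=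
    ((IsSmoothGerm.of_clm 𝔥.subtypeL).comp h.isSmoothGerm_right).tendsto
  have hpair : Tendsto (fun p : V × V => (graphMap φ p.1, graphMap φ p.2)) (𝓝 0) (𝓝 0) :=
    hs.prodMap_nhds hs
  refine ⟨hμ.map_zero, hμ.contDiffAt.continuousAt, ?_⟩
  filter_upwards [h.factor, hpair.eventually G.exp_bch,
    ((hs.comp hμ.tendsto).prodMk_nhds hk).eventually G.exp_bch,
    hμ.tendsto.eventually hφQ.mem, hk.eventually hexpH] with p hp hprod hfactor hμQ hkH
  refine ⟨hμQ, G.exp (k p), hkH.2 (SetLike.coe_mem _), ?_⟩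
  exact hprod.symm.trans ((congr_arg G.exp hp).trans hfactor)

theorem tendsto_point (hφ : IsSmoothGerm φ) : Tendsto (G.point φ) (𝓝 0) (𝓝 0) :=
  G.isSmoothGerm_exp.tendsto.comp (isSmoothGerm_graphMap hφ).tendsto

theorem tendsto_point_mul_point (hφ : IsSmoothGerm φ) :
    Tendsto (fun p : V × V => G.mul (G.point φ p.1) (G.point φ p.2)) (𝓝 0) (𝓝 0) := by
  have hfst : Tendsto (fun p : V × V => G.point φ p.1) (𝓝 0) (𝓝 0) :=
    (tendsto_point hφ).comp (IsSmoothGerm.of_clm (.fst ℝ V V)).tendsto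
  have hsnd : Tendsto (fun p : V × V => G.point φ p.2) (𝓝 0) (𝓝 0) :=
    (tendsto_point hφ).comp (IsSmoothGerm.of_clm (.snd ℝ V V)).tendsto
  exact G.isSmoothGerm_mulPair.tendsto.comp (hfst.prodMk_nhds hsnd)

theorem IsLoopLaw.exists_factor (hμ : G.IsLoopLaw H Q φ μ) (hφ : IsSmoothGerm φ)
    (hHU : H ⊆ G.U) (hc : V.IsTopCompl 𝔥) (hexpH : ∀ᶠ η in 𝓝 (0 : E), G.exp η ∈ H ↔ η ∈ 𝔥) :
    ∃ l : V × V → 𝔥, Tendsto l (𝓝 0) (𝓝 0) ∧ ∀ᶠ p : V × V in 𝓝 0,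
      G.bch (graphMap φ p.1, graphMap φ p.2) = G.bch (graphMap φ (μ p), (l p : E)) := by
  have hq := (tendsto_point (G := G) hφ).comp hμ.tendsto
  have hg := tendsto_point_mul_point (G := G) hφ
  have hqg := G.tendsto_inv_mul hq hg
  have hlog := G.isSmoothGerm_log.tendsto.comp hqg
  refine ⟨_, (IsSmoothGerm.of_clm (𝔥.projectionOntoL V hc.symm)).tendsto.comp hlog, ?_⟩
  filter_upwards [hμ.isProjection, hq.eventually_mem (G.isOpen_U₀.mem_nhds G.zero_mem_U₀),
    hg.eventually_mem G.U_mem_nhds, hqg.eventually G.exp_log, hlog.eventually hexpH]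
    with p ⟨_, h, hhH, hgqh⟩ hqU₀ hgU hexplog hlogH
  have hh : h = G.mul (G.inv (G.point φ (μ p))) (G.mul (G.point φ p.1) (G.point φ p.2)) := by
    rw [hgqh]
    exact G.eq_inv_mul hqU₀ (hHU hhH) (hgqh ▸ hgU)
  simp only [Function.comp_apply] at hexplog hlogH ⊢
  rw [← hh] at hexplog hlogH ⊢
  have hproj : (𝔥.projectionOntoL V hc.symm (G.log h) : E) = G.log h :=
    congr_arg Subtype.val
      (Submodule.projectionOntoL_apply_left hc.symm ⟨_, hlogH.1 (hexplog.symm ▸ hhH)⟩)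
  rw [hproj, bch, bch, hexplog]
  exact congr_arg G.log hgqh

theorem IsLocalLieSubgroup.exists_isLoopLaw (hH : G.IsLocalLieSubgroup H 𝔥)
    (hφQ : G.IsSectionMap Q φ) (hφ : IsSecondOrderGerm φ) (hc : V.IsTopCompl 𝔥) :
    ∃ μ, G.IsLoopLaw H Q φ μ := by
  have : CompleteSpace E := FiniteDimensional.complete ℝ E
  obtain ⟨μ, k, hμ, -⟩ := G.isNormalGroupGerm_bch.exists_isLoopGerm hφ hc
  exact ⟨μ, hμ.isLoopLaw hφQ hφ.toIsSmoothGerm (hH.exp_mem_iff hc)⟩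

theorem IsLoopLaw.exists_isLoopGerm (hμ : G.IsLoopLaw H Q φ μ) (hH : G.IsLocalLieSubgroup H 𝔥)
    (hφ : IsSecondOrderGerm φ) (hc : V.IsTopCompl 𝔥) :
    ∃ k : V × V → 𝔥, IsLoopGerm G.bch φ μ k := by
  have : CompleteSpace E := FiniteDimensional.complete ℝ E
  obtain ⟨l, hl, hfactor⟩ :=
    hμ.exists_factor hφ.toIsSmoothGerm hH.subset_U hc (hH.exp_mem_iff hc)
  obtain ⟨ν, k, hν, hunique⟩ := G.isNormalGroupGerm_bch.exists_isLoopGerm hφ hc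
  exact ⟨k, hν.congr' (hunique μ l hμ.tendsto hl hfactor)⟩

end LocalLieGroup

end LoopLaws

section LoopJets

variable {E : Type*} [NormedAddCommGroup E] [NormedSpace ℝ E] {V W : Submodule ℝ E}
  {m : E × E → E} {φ : V → W} {μ : V × V → V} {k : V × V → W}

/-- The quadratic part of a map, as a continuous bilinear map. -/
def quadraticPartL (φ : V → W) : V →L[ℝ] V →L[ℝ] W :=
  (1 / 2 : ℝ) • fderiv ℝ (fderiv ℝ φ) 0

theorem quadraticPartL_apply (φ : V → W) (x y : V) :
    quadraticPartL φ x y = quadraticPart φ x y := rfl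

namespace IsSecondOrderGerm

theorem quadraticPartL_symm (hφ : IsSecondOrderGerm φ) (x y : V) :
    quadraticPartL φ x y = quadraticPartL φ y x :=
  congr_arg ((1 / 2 : ℝ) • ·) (fderiv_fderiv_symm (hφ.contDiffAt.of_le ENat.LEInfty.out) x y)

theorem exists_hasCubicJet_graphMap (hφ : IsSecondOrderGerm φ) {u : ℝ → V} {a b c : V}
    (hu : HasCubicJet u a b c) : ∃ w : W, HasCubicJet (fun t => graphMap φ (u t))
      (a : E) (b + quadraticPartL φ a a) (c + (2 : ℝ) • quadraticPartL φ a b + w) := by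
  have hφu := hu.comp_contDiffAt (hφ.contDiffAt.of_le ENat.LEInfty.out) hφ.map_zero
  refine ⟨(1 / 6 : ℝ) • fderiv ℝ (fderiv ℝ (fderiv ℝ φ)) 0 a a a,
    ((hu.clm V.subtypeL).add (hφu.clm W.subtypeL)).congr_coeff ?_ ?_ ?_⟩ <;>
    simp only [hφ.fderiv_eq_zero, zero_apply, zero_add, add_zero, map_add, map_zero,
      quadraticPartL, smul_apply, Submodule.subtypeL_apply, Submodule.coe_smul]
  module

end IsSecondOrderGerm

/-- The mixed second derivative of the `W`-valued factor `k` in the equation defining a loop law on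
the graph of `φ`. -/
def factorXY (m : E × E → E) (φ : V → W) (hc : V.IsTopCompl W) : V →L[ℝ] V →L[ℝ] W :=
  (ContinuousLinearMap.compL ℝ V E W (W.projectionOntoL V hc.symm)).comp
    ((mixedXY m).bilinearComp V.subtypeL V.subtypeL) - (2 : ℝ) • quadraticPartL φ

theorem factorXY_apply (hc : V.IsTopCompl W) (x y : V) : factorXY m φ hc x y =
    W.projectionOntoL V hc.symm (mixedXY m x y) - (2 : ℝ) • quadraticPartL φ x y := rfl

namespace IsLoopGerm

theorem exists_jet_eq (h : IsLoopGerm m φ μ k) (hm : IsUnitalGerm m) (hφ : IsSecondOrderGerm φ)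
    (x y : V) : ∃ k₂ w : W,
      mixedXY m x y = mixedXY μ x y + ((2 : ℝ) • quadraticPartL φ x y + k₂ : W) ∧
      mixedXY m x (quadraticPartL φ y y) + mixedXY m (quadraticPartL φ x x) y +
          (1 / 2 : ℝ) • mixedXXY m x x y + (1 / 2 : ℝ) • mixedXYY m x y y =
        ((1 / 2 : ℝ) • mixedXXY μ x x y + (1 / 2 : ℝ) • mixedXYY μ x y y : V) +
          mixedXY m (x + y : V) k₂ + w := by
  have hx := HasCubicJet.line x
  have hy := HasCubicJet.line y
  obtain ⟨wx, hφx⟩ := hφ.exists_hasCubicJet_graphMap hx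
  obtain ⟨wy, hφy⟩ := hφ.exists_hasCubicJet_graphMap hy
  obtain ⟨wμ, hφμ⟩ := hφ.exists_hasCubicJet_graphMap (h.hasCubicJet hx hy)
  obtain ⟨k₁, k₂, k₃, hk⟩ := exists_hasCubicJet_comp
    (h.isSmoothGerm_right.contDiffAt.of_le ENat.LEInfty.out) h.isSmoothGerm_right.map_zero
    (hx.prodMk hy)
  obtain ⟨hlin, hquad, hcubic⟩ := ((hm.hasCubicJet hφx hφy).congr'
    (eventually_smul h.factor (x, y))).coeff_unique (hm.hasCubicJet hφμ (hk.clm W.subtypeL))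
  simp only [map_zero, zero_apply, zero_add, add_zero, Submodule.subtypeL_apply, map_add,
    add_apply, Submodule.coe_add, Submodule.coe_smul, hφ.quadraticPartL_symm y x]
    at hlin hquad hcubic
  obtain rfl : k₁ = 0 := Subtype.ext (left_eq_add.1 hlin)
  simp only [ZeroMemClass.coe_zero, map_zero, smul_zero, zero_apply, add_zero] at hquad hcubic
  refine ⟨k₂, k₃ + wμ - wx - wy +
    (2 : ℝ) • quadraticPartL φ x (mixedXY μ x y) + (2 : ℝ) • quadraticPartL φ y (mixedXY μ x y),
    ?_, ?_⟩
  · push_cast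
    linear_combination (norm := module) hquad
  · simp only [map_add, add_apply, Submodule.coe_add, Submodule.coe_sub, Submodule.coe_smul]
    linear_combination (norm := module) hcubic

theorem mixedXY_eq (h : IsLoopGerm m φ μ k) (hm : IsUnitalGerm m) (hφ : IsSecondOrderGerm φ)
    (hc : V.IsTopCompl W) (x y : V) :
    mixedXY μ x y = V.projectionOntoL W hc (mixedXY m x y) := by
  obtain ⟨k₂, -, hquad, -⟩ := h.exists_jet_eq hm hφ x y
  rw [hquad, projectionOntoL_add hc]

theorem mixedXXY_add_mixedXYY (h : IsLoopGerm m φ μ k) (hm : IsUnitalGerm m)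
    (hφ : IsSecondOrderGerm φ) (hc : V.IsTopCompl W) (x y : V) :
    mixedXXY μ x x y + mixedXYY μ x y y = V.projectionOntoL W hc
      ((2 : ℝ) • mixedXY m x (quadraticPartL φ y y) + (2 : ℝ) • mixedXY m (quadraticPartL φ x x) y
        + mixedXXY m x x y + mixedXYY m x y y
        - (2 : ℝ) • mixedXY m (x + y : V) (factorXY m φ hc x y)) := by
  obtain ⟨k₂, w, hquad, hcubic⟩ := h.exists_jet_eq hm hφ x y
  have hk₂ : factorXY m φ hc x y = k₂ := by
    rw [factorXY_apply, hquad, projectionOntoL_symm_add hc, add_sub_cancel_left]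
  have hproj := congr_arg (V.projectionOntoL W hc) hcubic
  rw [add_right_comm _ _ (w : E), map_add _ (_ + (w : E)), projectionOntoL_add hc] at hproj
  rw [hk₂]
  simp only [map_add, map_sub, map_smul] at hproj ⊢
  linear_combination (norm := module) (-2 : ℝ) • hproj

theorem mixedXXY_mixedXYY_diag (h : IsLoopGerm m φ μ k) (hm : IsUnitalGerm m)
    (hφ : IsSecondOrderGerm φ) (hc : V.IsTopCompl W) (x y : V) :
    mixedXXY μ x x y = V.projectionOntoL W hc ((2 : ℝ) • mixedXY m (quadraticPartL φ x x) y +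
      mixedXXY m x x y - (2 : ℝ) • mixedXY m x (factorXY m φ hc x y)) ∧
    mixedXYY μ x y y = V.projectionOntoL W hc ((2 : ℝ) • mixedXY m x (quadraticPartL φ y y) +
      mixedXYY m x y y - (2 : ℝ) • mixedXY m y (factorXY m φ hc x y)) := by
  have hpos := h.mixedXXY_add_mixedXYY hm hφ hc x y
  have hneg := h.mixedXXY_add_mixedXYY hm hφ hc x (-y)
  simp only [Submodule.coe_neg, Submodule.coe_add, map_neg, map_add, map_sub, map_smul, neg_apply,
    add_apply, neg_neg] at hpos hneg ⊢
  constructor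
  · linear_combination (norm := module) (1 / 2 : ℝ) • hpos - (1 / 2 : ℝ) • hneg
  · linear_combination (norm := module) (1 / 2 : ℝ) • hpos + (1 / 2 : ℝ) • hneg

theorem mixedXXY_eq (h : IsLoopGerm m φ μ k) (hm : IsUnitalGerm m) (hφ : IsSecondOrderGerm φ)
    (hc : V.IsTopCompl W) (x y z : V) :
    mixedXXY μ x y z = V.projectionOntoL W hc ((2 : ℝ) • mixedXY m (quadraticPartL φ x y) z +
      mixedXXY m x y z - mixedXY m x (factorXY m φ hc y z) -
      mixedXY m y (factorXY m φ hc x z)) := by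
  have hdiag := fun x => (h.mixedXXY_mixedXYY_diag hm hφ hc x z).1
  have hsum := hdiag (x + y)
  have hx := hdiag x
  have hy := hdiag y
  simp only [Submodule.coe_add, map_add, map_sub, map_smul, add_apply, h.mixedXXY_symm y x,
    hm.mixedXXY_symm (y : E) x, hφ.quadraticPartL_symm y x] at hsum hx hy ⊢
  linear_combination (norm := module) (1 / 2 : ℝ) • (hsum - hx - hy)

theorem mixedXYY_eq (h : IsLoopGerm m φ μ k) (hm : IsUnitalGerm m) (hφ : IsSecondOrderGerm φ)
    (hc : V.IsTopCompl W) (x y z : V) :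
    mixedXYY μ x y z = V.projectionOntoL W hc ((2 : ℝ) • mixedXY m x (quadraticPartL φ y z) +
      mixedXYY m x y z - mixedXY m y (factorXY m φ hc x z) -
      mixedXY m z (factorXY m φ hc x y)) := by
  have hdiag := fun y => (h.mixedXXY_mixedXYY_diag hm hφ hc x y).2
  have hsum := hdiag (y + z)
  have hy := hdiag y
  have hz := hdiag z
  simp only [Submodule.coe_add, map_add, map_sub, map_smul, add_apply, h.mixedXYY_symm x z y,
    hm.mixedXYY_symm x (z : E) y, hφ.quadraticPartL_symm z y] at hsum hy hz ⊢
  linear_combination (norm := module) (1 / 2 : ℝ) • (hsum - hy - hz)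

end IsLoopGerm

end LoopJets

section WebTensors

namespace ThreeWeb

variable {V : Type*} [NormedAddCommGroup V] [NormedSpace ℝ V] {μ : V × V → V}

/-- The torsion tensor at `(0, 0)` of the web of a local loop law with unit `0`. -/
def torsion (μ : V × V → V) : V →ₗ[ℝ] V →ₗ[ℝ] V :=
  LinearMap.mk₂ ℝ (fun x y => (1 / 2 : ℝ) • (mixedXY μ y x - mixedXY μ x y))
    (fun x x' y => by simp only [map_add, add_apply]; module)
    (fun c x y => by simp only [map_smul, smul_apply]; module)
    (fun x y y' => by simp only [map_add, add_apply]; module)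
    (fun c x y => by simp only [map_smul, smul_apply]; module)

/-- The curvature tensor at `(0, 0)` of the web of a local loop law with unit `0`. -/
def curvature (μ : V × V → V) : V →ₗ[ℝ] V →ₗ[ℝ] V →ₗ[ℝ] V :=
  LinearMap.mk₂ ℝ (fun x y => ((mixedXYY μ y x - mixedXXY μ y x - mixedXY μ (mixedXY μ y x)
      + (mixedXY μ y).comp (mixedXY μ x) : V →L[ℝ] V) : V →ₗ[ℝ] V))
    (fun x x' y => by
      ext z
      simp only [map_add, add_apply, sub_apply, ContinuousLinearMap.coe_coe,
        ContinuousLinearMap.comp_apply, LinearMap.add_apply]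
      abel)
    (fun c x y => by ext z; simp [smul_sub])
    (fun x y y' => by
      ext z
      simp only [map_add, add_apply, sub_apply, ContinuousLinearMap.coe_coe,
        ContinuousLinearMap.comp_apply, LinearMap.add_apply]
      abel)
    (fun c x y => by ext z; simp [smul_sub])

theorem torsion_apply (x y : V) :
    torsion μ x y = (1 / 2 : ℝ) • (mixedXY μ y x - mixedXY μ x y) := rfl

theorem curvature_apply (x y z : V) : curvature μ x y z = mixedXYY μ y x z - mixedXXY μ y x z -
    mixedXY μ (mixedXY μ y x) z + mixedXY μ y (mixedXY μ x z) := rfl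

theorem d_eq {α : V × V → (V × V →L[ℝ] V)} {p : V × V} (hα : DifferentiableAt ℝ α p)
    (u w : V × V) : d α p u w = fderiv ℝ α p u w - fderiv ℝ α p w u := by
  have h : HasFDerivAt
      (fun q => ContinuousAlternatingMap.ofSubsingleton ℝ (V × V) V (0 : Fin 1) (α q)) _ p :=
    (ContinuousAlternatingMap.ofSubsingletonLIE (𝕜 := ℝ) (E := V × V) (F := V)
      (0 : Fin 1)).toContinuousLinearEquiv.hasFDerivAt.comp p hα.hasFDerivAt
  rw [d, extDeriv, h.fderiv, ContinuousAlternatingMap.alternatizeUncurryFin_apply,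
    Fin.sum_univ_two, Fin.val_zero, Fin.val_one, pow_zero, pow_one, one_smul, neg_one_smul,
    ← sub_eq_add_neg]
  rfl

theorem P_eq {p : V × V} (hp : DifferentiableAt ℝ μ p) :
    P μ p = (fderiv ℝ μ p).comp (.inl ℝ V V) :=
  (hp.hasFDerivAt.comp p.1 (hasFDerivAt_prodMk_left p.1 p.2)).fderiv

theorem Q_eq {p : V × V} (hp : DifferentiableAt ℝ μ p) :
    Q μ p = (fderiv ℝ μ p).comp (.inr ℝ V V) :=
  (hp.hasFDerivAt.comp p.2 (hasFDerivAt_prodMk_right p.1 p.2)).fderiv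

theorem mixed_eq {p : V × V} (hp : ∀ᶠ q in 𝓝 p, DifferentiableAt ℝ μ q)
    (hp₂ : DifferentiableAt ℝ (fderiv ℝ μ) p) :
    mixed μ p = (fderiv ℝ (fderiv ℝ μ) p).bilinearComp (.inl ℝ V V) (.inr ℝ V V) := by
  have hline : Tendsto (fun x : V => (x, p.2)) (𝓝 p.1) (𝓝 p) :=
    (by fun_prop : Continuous fun x : V => (x, p.2)).tendsto p.1
  have hQ : (fun x => Q μ (x, p.2)) =ᶠ[𝓝 p.1]
      fun x => (fderiv ℝ μ (x, p.2)).comp (.inr ℝ V V) := by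
    filter_upwards [hline.eventually hp] with x hx using Q_eq hx
  have hD : HasFDerivAt (fun x => fderiv ℝ μ (x, p.2)) _ p.1 :=
    HasFDerivAt.comp p.1 (g := fderiv ℝ μ) (f := fun x => (x, p.2)) hp₂.hasFDerivAt
      (hasFDerivAt_prodMk_left p.1 p.2)
  rw [mixed, hQ.fderiv_eq,
    (hD.clm_comp (hasFDerivAt_const (ContinuousLinearMap.inr ℝ V V) p.1)).fderiv]
  ext u v
  simp

theorem P_eventuallyEq (hμ : ContDiffAt ℝ 1 μ 0) :
    P μ =ᶠ[𝓝 0] fun p => (fderiv ℝ μ p).comp (.inl ℝ V V) := by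
  filter_upwards [eventually_differentiableAt_of_contDiffAt hμ] with p hp using P_eq hp

theorem Q_eventuallyEq (hμ : ContDiffAt ℝ 1 μ 0) :
    Q μ =ᶠ[𝓝 0] fun p => (fderiv ℝ μ p).comp (.inr ℝ V V) := by
  filter_upwards [eventually_differentiableAt_of_contDiffAt hμ] with p hp using Q_eq hp

theorem mixed_eventuallyEq (hμ : ContDiffAt ℝ 2 μ 0) :
    mixed μ =ᶠ[𝓝 0] fun p =>
      (fderiv ℝ (fderiv ℝ μ) p).bilinearComp (.inl ℝ V V) (.inr ℝ V V) := by
  filter_upwards [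
    (eventually_differentiableAt_of_contDiffAt (hμ.of_le one_le_two)).eventually_nhds,
    eventually_differentiableAt_of_contDiffAt (hμ.fderiv_right (m := 1) (by norm_num))]
    with p hp hp₂ using mixed_eq hp hp₂

variable (hμ : IsUnitalGerm μ)
include hμ

theorem P_zero : P μ 0 = .id ℝ V := by
  rw [P_eq (hμ.contDiffAt.differentiableAt (by simp))]
  exact ContinuousLinearMap.ext fun x => (hμ.fderivs_inl x).1

theorem Q_zero : Q μ 0 = .id ℝ V := by
  rw [Q_eq (hμ.contDiffAt.differentiableAt (by simp))]
  exact ContinuousLinearMap.ext fun x => (hμ.fderivs_inr x).1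

theorem mixed_zero : mixed μ 0 = mixedXY μ :=
  (mixed_eventuallyEq hμ.contDiffAt_two).self_of_nhds

theorem Γ_zero (x y : V) : Γ μ 0 x y = -mixedXY μ x y := by
  simp [Γ, P_zero hμ, Q_zero hμ, mixed_zero hμ]

theorem ω₁_zero (u : V × V) : ω₁ μ 0 u = u.1 := by
  simp [ω₁, P_zero hμ]

theorem ω₂_zero (u : V × V) : ω₂ μ 0 u = u.2 := by
  simp [ω₂, Q_zero hμ]

theorem connectionForm_zero (v : V) (u : V × V) :
    connectionForm μ v 0 u = -mixedXY μ u.1 v - mixedXY μ v u.2 := by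
  simp [connectionForm, Γ_zero hμ, ω₁_zero hμ, ω₂_zero hμ, sub_eq_add_neg]

theorem differentiableAt_P : DifferentiableAt ℝ (P μ) 0 :=
  (((hμ.contDiffAt_two.fderiv_right (m := 1) (by norm_num)).differentiableAt one_ne_zero).clm_comp
    (differentiableAt_const _)).congr_of_eventuallyEq
      (P_eventuallyEq (hμ.contDiffAt_two.of_le one_le_two))

theorem differentiableAt_Q : DifferentiableAt ℝ (Q μ) 0 :=
  (((hμ.contDiffAt_two.fderiv_right (m := 1) (by norm_num)).differentiableAt one_ne_zero).clm_comp
    (differentiableAt_const _)).congr_of_eventuallyEq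
      (Q_eventuallyEq (hμ.contDiffAt_two.of_le one_le_two))

theorem fderiv_P_apply (u : V × V) (x : V) : fderiv ℝ (P μ) 0 u x = mixedXY μ x u.2 := by
  have hd := (hμ.contDiffAt_two.fderiv_right (m := 1) (by norm_num)).differentiableAt one_ne_zero
  rw [(P_eventuallyEq (hμ.contDiffAt_two.of_le one_le_two)).fderiv_eq,
    (hd.hasFDerivAt.clm_comp (hasFDerivAt_const _ _)).fderiv]
  simpa using hμ.fderiv_fderiv_apply u.1 u.2 x 0

theorem fderiv_Q_apply (u : V × V) (x : V) : fderiv ℝ (Q μ) 0 u x = mixedXY μ u.1 x := by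
  have hd := (hμ.contDiffAt_two.fderiv_right (m := 1) (by norm_num)).differentiableAt one_ne_zero
  rw [(Q_eventuallyEq (hμ.contDiffAt_two.of_le one_le_two)).fderiv_eq,
    (hd.hasFDerivAt.clm_comp (hasFDerivAt_const _ _)).fderiv]
  simpa using hμ.fderiv_fderiv_apply u.1 u.2 0 x

theorem differentiableAt_mixed : DifferentiableAt ℝ (mixed μ) 0 :=
  (differentiableAt_bilinearComp (((hμ.contDiffAt_three.fderiv_right (m := 2)
    (by norm_num)).fderiv_right (m := 1) (by norm_num)).differentiableAt one_ne_zero)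
    (differentiableAt_const _) (differentiableAt_const _)).congr_of_eventuallyEq
      (mixed_eventuallyEq hμ.contDiffAt_two)

theorem fderiv_mixed_apply (u : V × V) (x y : V) : fderiv ℝ (mixed μ) 0 u x y =
    mixedXXY μ u.1 x y + mixedXYY μ x u.2 y := by
  have hd := ((hμ.contDiffAt_three.fderiv_right (m := 2) (by norm_num)).fderiv_right (m := 1)
    (by norm_num)).differentiableAt one_ne_zero
  have heq : (fun p => mixed μ p x y) =ᶠ[𝓝 0]
      fun p => fderiv ℝ (fderiv ℝ μ) p (x, 0) (0, y) := by
    filter_upwards [mixed_eventuallyEq hμ.contDiffAt_two] with p hp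
    rw [hp]
    rfl
  rw [← fderiv_clm_apply_apply (differentiableAt_mixed hμ), heq.fderiv_eq,
    fderiv_clm_apply_apply hd]
  change fderiv ℝ (fderiv ℝ (fderiv ℝ μ)) 0 (u.1, u.2) (x, 0) (0, y) = _
  rw [prodMk_eq_inl_add_inr u.1, map_add, add_apply, add_apply,
    fderiv_fderiv_fderiv_symm_left hμ.contDiffAt_three (0, u.2)]
  rfl

theorem hasFDerivAt_inverse_P [CompleteSpace V] :
    HasFDerivAt (fun p => (P μ p).inverse) (-fderiv ℝ (P μ) 0) 0 := by
  have hinv := hasFDerivAt_inverse_id (X := V)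
  rw [← P_zero hμ] at hinv
  exact (hinv.comp 0 (differentiableAt_P hμ).hasFDerivAt).congr_fderiv rfl

theorem hasFDerivAt_inverse_Q [CompleteSpace V] :
    HasFDerivAt (fun p => (Q μ p).inverse) (-fderiv ℝ (Q μ) 0) 0 := by
  have hinv := hasFDerivAt_inverse_id (X := V)
  rw [← Q_zero hμ] at hinv
  exact (hinv.comp 0 (differentiableAt_Q hμ).hasFDerivAt).congr_fderiv rfl

theorem differentiableAt_Γ [CompleteSpace V] : DifferentiableAt ℝ (Γ μ) 0 := by
  have h := differentiableAt_bilinearComp (differentiableAt_mixed hμ)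
    (hasFDerivAt_inverse_P hμ).differentiableAt (hasFDerivAt_inverse_Q hμ).differentiableAt
  exact DifferentiableAt.neg (𝕜 := ℝ) (F := V →L[ℝ] V →L[ℝ] V) h

theorem fderiv_Γ_apply [CompleteSpace V] (u : V × V) (x y : V) : fderiv ℝ (Γ μ) 0 u x y =
    mixedXY μ (mixedXY μ x u.2) y + mixedXY μ x (mixedXY μ u.1 y) -
      (mixedXXY μ u.1 x y + mixedXYY μ x u.2 y) := by
  have h : HasFDerivAt (fun p => Γ μ p x y) _ 0 :=
    (((differentiableAt_mixed hμ).hasFDerivAt.clm_apply ((hasFDerivAt_inverse_P hμ).clm_apply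
      (hasFDerivAt_const x (0 : V × V)))).clm_apply
      ((hasFDerivAt_inverse_Q hμ).clm_apply (hasFDerivAt_const y (0 : V × V)))).neg
  rw [← fderiv_clm_apply_apply (differentiableAt_Γ hμ), h.fderiv]
  simp only [P_zero hμ, Q_zero hμ, ContinuousLinearMap.inverse_id, mixed_zero hμ, add_apply,
    neg_apply, ContinuousLinearMap.comp_apply, ContinuousLinearMap.flip_apply, zero_apply,
    map_zero, zero_add, ContinuousLinearMap.id_apply, fderiv_P_apply hμ, fderiv_Q_apply hμ,
    fderiv_mixed_apply hμ, map_neg]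
  abel

theorem differentiableAt_ω₁ : DifferentiableAt ℝ (ω₁ μ) 0 :=
  (differentiableAt_P hμ).clm_comp (differentiableAt_const _)

theorem differentiableAt_ω₂ : DifferentiableAt ℝ (ω₂ μ) 0 :=
  (differentiableAt_Q hμ).clm_comp (differentiableAt_const _)

theorem fderiv_ω₁_apply (u w : V × V) : fderiv ℝ (ω₁ μ) 0 u w = mixedXY μ w.1 u.2 := by
  have h : HasFDerivAt (ω₁ μ) _ 0 := (differentiableAt_P hμ).hasFDerivAt.clm_comp
    (hasFDerivAt_const (ContinuousLinearMap.fst ℝ V V) (0 : V × V))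
  simp [h.fderiv, fderiv_P_apply hμ]

theorem fderiv_ω₂_apply (u w : V × V) : fderiv ℝ (ω₂ μ) 0 u w = mixedXY μ u.1 w.2 := by
  have h : HasFDerivAt (ω₂ μ) _ 0 := (differentiableAt_Q hμ).hasFDerivAt.clm_comp
    (hasFDerivAt_const (ContinuousLinearMap.snd ℝ V V) (0 : V × V))
  simp [h.fderiv, fderiv_Q_apply hμ]

theorem differentiableAt_connectionForm [CompleteSpace V] (v : V) :
    DifferentiableAt ℝ (connectionForm μ v) 0 :=
  (((differentiableAt_flip (differentiableAt_Γ hμ)).clm_apply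
    (differentiableAt_const v)).clm_comp (differentiableAt_ω₁ hμ)).add
      (((differentiableAt_Γ hμ).clm_apply (differentiableAt_const v)).clm_comp
        (differentiableAt_ω₂ hμ))

theorem fderiv_connectionForm_apply [CompleteSpace V] (v : V) (u w : V × V) :
    fderiv ℝ (connectionForm μ v) 0 u w =
      mixedXY μ w.1 (mixedXY μ u.1 v) + mixedXY μ (mixedXY μ v u.2) w.2 -
        (mixedXXY μ u.1 w.1 v + mixedXYY μ w.1 u.2 v) -
        (mixedXXY μ u.1 v w.2 + mixedXYY μ v u.2 w.2) := by
  have hΓ := (differentiableAt_Γ hμ).hasFDerivAt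
  have hv := hasFDerivAt_const (𝕜 := ℝ) v (0 : V × V)
  have hw := hasFDerivAt_const (𝕜 := ℝ) w (0 : V × V)
  have h := ((hΓ.clm_apply ((differentiableAt_ω₁ hμ).hasFDerivAt.clm_apply hw)).clm_apply
    hv).fun_add ((hΓ.clm_apply hv).clm_apply ((differentiableAt_ω₂ hμ).hasFDerivAt.clm_apply hw))
  have happly := (differentiableAt_connectionForm hμ v).hasFDerivAt.clm_apply hw
  have heq := congr_arg (fun L : V × V →L[ℝ] V => L u) (happly.unique h)
  simp only [add_apply, ContinuousLinearMap.comp_apply, ContinuousLinearMap.flip_apply,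
    zero_apply, map_zero, Prod.fst_zero, Prod.snd_zero, zero_add, fderiv_Γ_apply hμ,
    fderiv_ω₁_apply hμ, fderiv_ω₂_apply hμ, ω₁_zero hμ, ω₂_zero hμ, Γ_zero hμ] at heq
  rw [heq]
  abel

omit hμ in
theorem HasTensorsAt.eq_torsion (hμ : IsUnitalGerm μ) {a : V →ₗ[ℝ] V →ₗ[ℝ] V}
    {b : V →ₗ[ℝ] V →ₗ[ℝ] V →ₗ[ℝ] V} (h : HasTensorsAt μ 0 a b) : a = torsion μ := by
  refine LinearMap.ext₂ fun x y => ?_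
  have hxy := h.d_ω₁ (x, 0) (y, 0)
  simp only [d_eq (differentiableAt_ω₁ hμ), fderiv_ω₁_apply hμ, ω₁_zero hμ,
    connectionForm_zero hμ, map_zero, h.skew y x] at hxy
  rw [torsion_apply]
  linear_combination (norm := module) (-1 / 2 : ℝ) • hxy

omit hμ in
theorem HasTensorsAt.eq_curvature [CompleteSpace V] (hμ : IsUnitalGerm μ)
    {a : V →ₗ[ℝ] V →ₗ[ℝ] V} {b : V →ₗ[ℝ] V →ₗ[ℝ] V →ₗ[ℝ] V} (h : HasTensorsAt μ 0 a b) :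
    b = curvature μ := by
  refine LinearMap.ext₂ fun x y => LinearMap.ext fun z => ?_
  have hxyz := h.d_connectionForm x (y, 0) (0, z)
  simp only [d_eq (differentiableAt_connectionForm hμ x), fderiv_connectionForm_apply hμ,
    ω₁_zero hμ, ω₂_zero hμ, connectionForm_zero hμ, map_zero, zero_apply, map_neg, neg_apply,
    neg_zero, sub_zero, zero_sub, add_zero, zero_add, neg_neg, hμ.mixedXYY_symm y z x] at hxyz
  rw [curvature_apply]
  linear_combination (norm := module) -hxyz

theorem hasTensorsAt_torsion_curvature [CompleteSpace V] :
    HasTensorsAt μ 0 (torsion μ) (curvature μ) where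
  skew x y := by
    rw [torsion_apply, torsion_apply]
    module
  d_ω₁ u w := by
    simp only [d_eq (differentiableAt_ω₁ hμ), fderiv_ω₁_apply hμ, ω₁_zero hμ,
      connectionForm_zero hμ, torsion_apply]
    module
  d_ω₂ u w := by
    simp only [d_eq (differentiableAt_ω₂ hμ), fderiv_ω₂_apply hμ, ω₂_zero hμ,
      connectionForm_zero hμ, torsion_apply]
    module
  d_connectionForm v u w := by
    simp only [d_eq (differentiableAt_connectionForm hμ v), fderiv_connectionForm_apply hμ,
      ω₁_zero hμ, ω₂_zero hμ, connectionForm_zero hμ, curvature_apply, map_sub, map_neg,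
      sub_apply, neg_apply]
    rw [hμ.mixedXXY_symm u.1 w.1, hμ.mixedXYY_symm w.1 u.2, hμ.mixedXYY_symm u.1 w.2,
      hμ.mixedXYY_symm v u.2]
    module

theorem hasTensorsAt_iff [CompleteSpace V] {a : V →ₗ[ℝ] V →ₗ[ℝ] V}
    {b : V →ₗ[ℝ] V →ₗ[ℝ] V →ₗ[ℝ] V} :
    HasTensorsAt μ 0 a b ↔ a = torsion μ ∧ b = curvature μ :=
  ⟨fun h => ⟨h.eq_torsion hμ, h.eq_curvature hμ⟩,
    fun ⟨ha, hb⟩ => ha ▸ hb ▸ hasTensorsAt_torsion_curvature hμ⟩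

end ThreeWeb

end WebTensors

namespace IsLoopGerm

variable {E : Type*} [NormedAddCommGroup E] [NormedSpace ℝ E] {V W : Submodule ℝ E}
  {m : E × E → E} {φ : V → W} {μ : V × V → V} {k : V × V → W}

theorem torsion_eq (h : IsLoopGerm m φ μ k) (hm : IsNormalGroupGerm m) (hφ : IsSecondOrderGerm φ)
    (hc : V.IsTopCompl W) (x y : V) :
    ThreeWeb.torsion μ x y = -V.projectionOntoL W hc (mixedXY m x y) := by
  rw [ThreeWeb.torsion_apply, h.mixedXY_eq hm.toIsUnitalGerm hφ hc,
    h.mixedXY_eq hm.toIsUnitalGerm hφ hc, hm.mixedXY_antisymm y, map_neg]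
  module

theorem curvature_eq (h : IsLoopGerm m φ μ k) (hm : IsNormalGroupGerm m)
    (hφ : IsSecondOrderGerm φ) (hc : V.IsTopCompl W) (x y z : V) :
    ThreeWeb.curvature μ x y z =
      -(2 : ℝ) • V.projectionOntoL W hc (mixedXY m (mixedXY m x y) z) +
      (2 : ℝ) • V.projectionOntoL W hc (mixedXY m (V.projectionOntoL W hc (mixedXY m x y)) z) -
      (4 : ℝ) • V.projectionOntoL W hc (mixedXY m (quadraticPartL φ x y) z) := by
  have hu := hm.toIsUnitalGerm
  have hW (e : E) : (W.projectionOntoL V hc.symm e : E) = e - V.projectionOntoL W hc e :=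
    eq_sub_of_add_eq' (projectionOntoL_add_projectionOntoL_symm hc e)
  have hjacobi := congr_arg (V.projectionOntoL W hc) (hm.jacobi x y z)
  have hz (w : E) := congr_arg (V.projectionOntoL W hc) (hm.mixedXY_antisymm z w)
  have hzR := hz (quadraticPartL φ x y)
  have hzxy := hz (mixedXY m x y)
  have hzV := hz (V.projectionOntoL W hc (mixedXY m y x))
  rw [ThreeWeb.curvature_apply, h.mixedXXY_eq hu hφ hc, h.mixedXYY_eq hu hφ hc,
    hm.mixedXXY_eq, hm.mixedXYY_eq]
  simp only [h.mixedXY_eq hu hφ hc, factorXY_apply, hφ.quadraticPartL_symm y x,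
    hm.mixedXY_antisymm z y, hm.mixedXY_antisymm (y : E) x, hW, Submodule.coe_sub,
    Submodule.coe_smul, Submodule.coe_neg, map_add, map_sub, map_smul, map_neg, neg_apply]
    at hjacobi hzR hzxy hzV ⊢
  linear_combination (norm := module) (2 / 3 : ℝ) • hjacobi + hzV + (2 : ℝ) • hzR + (2 : ℝ) • hzxy

end IsLoopGerm

end

theorem proposition3p1 {E : Type*} [NormedAddCommGroup E] [NormedSpace ℝ E]
    [FiniteDimensional ℝ E] (G : LocalLieGroup E) (H Q : Set E) (V 𝔥 : Submodule ℝ E)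
    (hH : G.IsLocalLieSubgroup H 𝔥) (hQ : LocalLieGroup.IsLocalSection Q V 𝔥) :
    (∃ (φ : V → 𝔥) (μ : V × V → V), G.IsSectionMap Q φ ∧ G.IsLoopLaw H Q φ μ) ∧
    ∀ (φ : V → 𝔥) (μ : V × V → V), G.IsSectionMap Q φ → G.IsLoopLaw H Q φ μ →
      ContDiffAt ℝ ∞ φ 0 ∧ fderiv ℝ φ 0 = 0 ∧ ContDiffAt ℝ ∞ μ 0 ∧
      (∃ (a : V →ₗ[ℝ] V →ₗ[ℝ] V) (b : V →ₗ[ℝ] V →ₗ[ℝ] V →ₗ[ℝ] V),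
        ThreeWeb.HasTensorsAt μ 0 a b) ∧
      ∀ (a : V →ₗ[ℝ] V →ₗ[ℝ] V) (b : V →ₗ[ℝ] V →ₗ[ℝ] V →ₗ[ℝ] V),
        ThreeWeb.HasTensorsAt μ 0 a b →
        (∀ x y : V, a x y =
          -(1 / 2 : ℝ) • V.projectionOnto 𝔥 hQ.isCompl (G.bracket x y)) ∧
        ∀ x y z : V, b x y z =
          -(1 / 2 : ℝ) • V.projectionOnto 𝔥 hQ.isCompl (G.bracket (G.bracket x y) z)
          + (1 / 2 : ℝ) • V.projectionOnto 𝔥 hQ.isCompl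
              (G.bracket (V.projectionOnto 𝔥 hQ.isCompl (G.bracket x y)) z)
          - (2 : ℝ) • V.projectionOnto 𝔥 hQ.isCompl (G.bracket (quadraticPart φ x y : 𝔥) z) := by
  have hc : V.IsTopCompl 𝔥 :=
    Submodule.IsCompl.isTopCompl_of_isClosed_of_finiteDimensional hQ.isCompl
      V.closed_of_finiteDimensional
  have hπ (e : E) : V.projectionOnto 𝔥 hQ.isCompl e = V.projectionOntoL 𝔥 hc e := rfl
  have : CompleteSpace V := FiniteDimensional.complete ℝ V
  have hm := G.isNormalGroupGerm_bch
  refine ⟨?_, fun φ μ hφQ hμ => ?_⟩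
  · obtain ⟨φ, hφQ⟩ := G.exists_isSectionMap hQ.isSubmanifold hc
    have hφ := hφQ.isSecondOrderGerm hQ.isSubmanifold hc
    obtain ⟨μ, hμ⟩ := hH.exists_isLoopLaw hφQ hφ hc
    exact ⟨φ, μ, hφQ, hμ⟩
  have hφ := hφQ.isSecondOrderGerm hQ.isSubmanifold hc
  obtain ⟨k, h⟩ := hμ.exists_isLoopGerm hH hφ hc
  refine ⟨hφ.contDiffAt, hφ.fderiv_eq_zero, h.contDiffAt,
    ⟨_, _, ThreeWeb.hasTensorsAt_torsion_curvature h.toIsUnitalGerm⟩, fun a b hab => ?_⟩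
  obtain ⟨rfl, rfl⟩ := (ThreeWeb.hasTensorsAt_iff h.toIsUnitalGerm).1 hab
  constructor
  · intro x y
    rw [h.torsion_eq hm hφ hc, G.bracket_eq_bch, hπ, map_smul]
    module
  · intro x y z
    rw [h.curvature_eq hm hφ hc]
    simp only [G.bracket_eq_bch, hπ, map_smul, smul_apply, Submodule.coe_smul,
      quadraticPartL_apply]
    module
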